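/- Let $W$ be a standard Brownian motion with $W(0)=0$. For $b\neq 0$ and $\varepsilon>0$ let $V_\varepsilon(b)=\varepsilon^{-1}\,\mathrm{Leb}\{t\ge 0: |W(t)-bt|\le \varepsilon/2\}$, and for $0<b<c$ let $(V(b),V(c))$ denote a pair of random variables that is the limit in distribution of $(V_\varepsilon(b),V_\varepsilon(c))$ as $\varepsilon\downarrow 0$ (the limit exists, and its law is unique). A path of length $n$ is a word $e=(e_1,\dots,e_n)$ with letters $e_k\in\{b,c\}$. Read backwards, $(e_n,\dots,e_1)$ consists of $i(0)\ge 0$ letters $b$ first, then $i(1)$ letters $c$, then $i(2)$ letters $b$, and so on, where each block is as long as possible (so only $i(0)$, or the blocks after the end of the word, can be empty). Put $b_j=b+j(c-b)$ and $$g(e)=\prod_{j=0}^{n}\Bigl(\frac1{b_j}\Bigr)^{i(j)} .$$ Let $0<b<c$. Then the following hold. (i) For every $n\ge 0$ and every path $e$ of length $n$, $$\int_{0<t_1<\cdots<t_n} f_{t_1,\dots,t_n}(e_1t_1,\dots,e_nt_n)\,dt_1\cdots dt_n=g(e),$$ where $f_{t_1,\dots,t_n}(x_1,\dots,x_n)=\prod_{k=1}^n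 (2\pi(t_k-t_{k-1}))^{-1/2}\exp\{-(x_k-x_{k-1})^2/(2(t_k-t_{k-1}))\}$ with $t_0=x_0=0$ is the density of $(W(t_1),\dots,W(t_n))$. (ii) For all integers $p,q\ge 0$, let $\mathcal P_{p,q}$ be the set of paths of length $p+q$ with $p$ letters $b$ and $q$ letters $c$. It has $\binom{p+q}{p}$ elements, each of which satisfies $i(0)+i(2)+\cdots=p$ and $i(1)+i(3)+\cdots=q$, and $$E\,V(b)^pV(c)^q=p!\,q!\sum_{e\in\mathcal P_{p,q}} g(e),$$ where the expectation is finite. (iii) For real $s,t$ the double series $$\sum_{p,q\ge 0}s^pt^q\sum_{e\in\mathcal P_{p,q}}g(e)$$ converges absolutely if and only if $E\exp\{|s|V(b)+|t|V(c)\}<\infty$, in particular whenever $|s|/b+|t|/c<1$; and whenever it converges absolutely, $E\exp\{sV(b)+tV(c)\}$ is finite and equal to its sum. -/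

import Mathlib

open MeasureTheory ProbabilityTheory Filter Topology
open scoped NNReal Nat

noncomputable section

/-- The relative time `V_ε(b)` which the process `W` spends along the ray `x = b t`: `1 / ε` times
the Lebesgue measure of the times `t ≥ 0` with `b t - ε / 2 ≤ W t ≤ b t + ε / 2`. -/
def relTime {Ω : Type*} (W : ℝ≥0 → Ω → ℝ) (b ε : ℝ) (ω : Ω) : ℝ :=
  ε⁻¹ * volume.real {t : ℝ | 0 ≤ t ∧ |W t.toNNReal ω - b * t| ≤ ε / 2}

/-- `(X, Y)` is a version of the pair `(V(b), V(c))` of total relative times spent by `W` along the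
rays `x = b t` and `x = c t`: the limit in distribution, as `ε` decreases to zero, of the pairs
`(V_ε(b), V_ε(c))`. -/
def IsTotalRelTimePair {Ω Ω' : Type*} [MeasurableSpace Ω] [MeasurableSpace Ω']
    (W : ℝ≥0 → Ω → ℝ) (P : Measure Ω) [IsProbabilityMeasure P] (b c : ℝ)
    (X Y : Ω' → ℝ) (P' : Measure Ω') [IsProbabilityMeasure P'] : Prop :=
  TendstoInDistribution (fun (ε : ℝ) (ω : Ω) => (relTime W b ε ω, relTime W c ε ω)) (𝓝[>] 0)
    (fun ω' => (X ω', Y ω')) (fun _ => P) P'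

/-- The density at `x` of `(W(t₁), …, W(tₙ))`, for a standard Brownian motion `W` and times
`0 < t₁ < ⋯ < tₙ`: the product of the densities of the independent increments
(with `t₀ = 0` and `x₀ = 0`). -/
def brownianDensity {n : ℕ} (t x : Fin n → ℝ) : ℝ :=
  ∏ i : Fin n,
    gaussianPDFReal 0
      ((Fin.cons 0 t : Fin (n + 1) → ℝ) i.succ
        - (Fin.cons 0 t : Fin (n + 1) → ℝ) i.castSucc).toNNReal
      ((Fin.cons 0 x : Fin (n + 1) → ℝ) i.succ - (Fin.cons 0 x : Fin (n + 1) → ℝ) i.castSucc)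

/-- The ordered times `0 < t₁ < ⋯ < tₙ`. -/
def orderedTimes (n : ℕ) : Set (Fin n → ℝ) := {t | (∀ i, 0 < t i) ∧ StrictMono t}

/-- The slope of a letter of a path type: `false` stands for `b` and `true` for `c`. -/
def raySlope (b c : ℝ) (x : Bool) : ℝ := if x then c else b

/-- The path types `(e₁, …, e_{p+q})` with `p` letters `b` and `q` letters `c`. -/
def pathTypes (p q : ℕ) : Finset (Fin (p + q) → Bool) :=
  {e | (Finset.univ.filter (fun k => e k = false)).card = p ∧
    (Finset.univ.filter (fun k => e k = true)).card = q}

/-- Split a word into alternating (possibly empty) blocks, the first made of letters `x`, the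
second of letters `!x`, and so on, each as long as possible: the length of block number `j`
(counted from zero). -/
def blockLength : ℕ → Bool → List Bool → ℕ
  | 0, x, l => (l.takeWhile (fun y => y == x)).length
  | j + 1, x, l => blockLength j (!x) (l.dropWhile (fun y => y == x))

/-- The run lengths `i(0), i(1), …` of a path type read backwards: `(eₙ, …, e₁)` has `i(0)`
letters `b` first, then `i(1)` letters `c`, then `i(2)` letters `b`, and so on. -/
def runLength {n : ℕ} (e : Fin n → Bool) (j : ℕ) : ℕ :=
  blockLength j false (List.ofFn e).reverse

/-- `g(path) = ∏_{j = 0}^{n} (1 / b_j) ^ i(j)` with `b_j = b + j (c - b)`. -/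
def pathWeight (b c : ℝ) {n : ℕ} (e : Fin n → Bool) : ℝ :=
  ∏ j ∈ Finset.range (n + 1), (1 / (b + (j : ℝ) * (c - b))) ^ runLength e j

end

/-! ### Words and their weights -/

section Words

/-! Part (i) rests on one integral. Suppose the last remaining letter has slope `a`, its predecessor
slope `v`, and all later times have been integrated out, leaving a factor `exp (-λ s)`. Integrating
the Gaussian increment over `s > t` gives `(1/m) exp (-λ' t)` with `m² = a² + 2λ` and `λ' = λ + a (a
- v) + m |a - v|`. The exponential shape is reproduced, so the times can be removed from the last to
the first. With `λ = (m² - a²)/2` one finds `λ' = ((m + |a - v|)² - v²)/2`: `m` stays put while the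
letter repeats and grows by `c - b` when it changes. Starting from `λ = 0`, where `m = a` is `b_0`
or `b_1`, the number `m` runs through the `b_j`, one step per block, and the factors `1/m` multiply
up to `g(e)`. This is `lintegral_gaussianPDFReal_ray`, `blockRate_step` and
`lintegral_orderedTimes_word`.

For (ii), Tonelli writes the mean of a product of occupation times, each with its own window width,
as an integral of box probabilities over all times. Sorting the times gives a sum over permutations
of averages, over a small box of shifts `y`, of the integral in (i) with its points moved by `y`
(`lintegral_prod_occupation`). That integral is continuous at `y = 0`, by domination by the word
with all letters `b` (`brownianDensity_shift_le`), so the moments converge; each word with `p`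
letters `b` and `q` letters `c` arises from `p! q!` permutations.

The independent widths also produce the limit pair: the mean of the product at width `ε` times the
product at width `ε'` converges as both widths vanish, which forces every product to be Cauchy in
`L²` (`exists_tendsto_of_tendsto_inner`). Hence the limits live on the space of `W`, and their
moments are the limits of the moments (`exists_limit_pair`). Uniqueness of limits in distribution
carries this over to any version of the pair.

Part (iii) expands the exponential of nonnegative variables term by term: Tonelli for `|s|`, `|t|`,
then absolute convergence for the signs. -/

/-- The weight of a word read from its first letter on, when the current block has index `j` and
consists of letters `x`. -/
noncomputable def wordWeight (b c : ℝ) : ℕ → Bool → List Bool → ℝ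
  | _, _, [] => 1
  | j, x, a :: l =>
    (1 / (b + ((if a = x then j else j + 1 : ℕ) : ℝ) * (c - b))) *
      wordWeight b c (if a = x then j else j + 1) a l

lemma blockLength_nil (j : ℕ) (x : Bool) : blockLength j x [] = 0 := by
  induction j generalizing x with
  | zero => rfl
  | succ j ih => simpa [blockLength] using ih _

lemma blockLength_zero_cons_self (x : Bool) (l : List Bool) :
    blockLength 0 x (x :: l) = blockLength 0 x l + 1 := by
  simp [blockLength]

lemma blockLength_succ_cons_self (j : ℕ) (x : Bool) (l : List Bool) :
    blockLength (j + 1) x (x :: l) = blockLength (j + 1) x l := by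
  simp [blockLength]

lemma blockLength_zero_cons_of_ne {x a : Bool} (h : a ≠ x) (l : List Bool) :
    blockLength 0 x (a :: l) = 0 := by
  simp [blockLength, h]

lemma blockLength_succ_cons_of_ne {x a : Bool} (h : a ≠ x) (j : ℕ) (l : List Bool) :
    blockLength (j + 1) x (a :: l) = blockLength j a (a :: l) := by
  have : (!x) = a := by cases a <;> cases x <;> simp_all
  simp [blockLength, h, this]

/-- A letter equal to the current one lengthens the current block by one. A different letter leaves
that block empty and is read again as the start of the next one, so that case is `key` with the
index advanced and one factor fewer. -/
lemma prod_blockLength (b c : ℝ) (l : List Bool) : ∀ (j : ℕ) (x : Bool) (N : ℕ), l.length ≤ N →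
    ∏ i ∈ Finset.range (N + 1), (1 / (b + ((j + i : ℕ) : ℝ) * (c - b))) ^ blockLength i x l
      = wordWeight b c j x l := by
  induction l with
  | nil => intro j x N _; simp [blockLength_nil, wordWeight]
  | cons a l ih =>
    have key : ∀ (j : ℕ) (N : ℕ), l.length ≤ N →
        ∏ i ∈ Finset.range (N + 1),
          (1 / (b + ((j + i : ℕ) : ℝ) * (c - b))) ^ blockLength i a (a :: l)
        = (1 / (b + (j : ℝ) * (c - b))) * wordWeight b c j a l := by
      intro j N hN
      rw [← ih j a N hN, Finset.prod_range_succ', Finset.prod_range_succ']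
      simp only [blockLength_zero_cons_self, blockLength_succ_cons_self, add_zero, pow_succ]
      ring
    intro j x N hN
    rw [List.length_cons] at hN
    by_cases h : a = x
    · subst h
      simpa [wordWeight] using key j N (by omega)
    · obtain ⟨N, rfl⟩ : ∃ M, N = M + 1 := ⟨N - 1, by omega⟩
      rw [Finset.prod_range_succ']
      simp only [blockLength_zero_cons_of_ne h, blockLength_succ_cons_of_ne h, pow_zero, mul_one]
      simp only [wordWeight, if_neg h]
      rw [← key (j + 1) N (by omega)]
      refine Finset.prod_congr rfl fun i _ => ?_
      rw [show j + (i + 1) = j + 1 + i by ring]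

lemma pathWeight_eq_wordWeight (b c : ℝ) {n : ℕ} (e : Fin n → Bool) :
    pathWeight b c e = wordWeight b c 0 false (List.ofFn e).reverse := by
  rw [← prod_blockLength b c _ 0 false n (by simp)]
  simp [pathWeight, runLength]

/-- Letters alternate from block to block, so even blocks collect the starting letter and odd blocks
the other one. Moving on to the next block swaps the two parities. -/
lemma sum_blockLength (l : List Bool) : ∀ (x : Bool) (N : ℕ), l.length ≤ N →
    (∑ i ∈ (Finset.range (N + 1)).filter Even, blockLength i x l = l.count x ∧
    ∑ i ∈ (Finset.range (N + 1)).filter Odd, blockLength i x l = l.count (!x)) := by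
  simp only [Finset.sum_filter]
  induction l with
  | nil => intro x N _; simp [blockLength_nil]
  | cons a l ih =>
    have key : ∀ N : ℕ, l.length ≤ N →
        ((∑ i ∈ Finset.range (N + 1), if Even i then blockLength i a (a :: l) else 0)
          = (a :: l).count a ∧
        (∑ i ∈ Finset.range (N + 1), if Odd i then blockLength i a (a :: l) else 0)
          = (a :: l).count (!a)) := by
      intro N hN
      have h := ih a N hN
      rw [Finset.sum_range_succ', Finset.sum_range_succ'] at h ⊢
      simp only [blockLength_zero_cons_self, blockLength_succ_cons_self]
      simp only [Even.zero, if_true, Nat.not_odd_zero, if_false] at h ⊢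
      simp only [List.count_cons]
      constructor
      · rw [← add_assoc, h.1]; simp
      · rw [h.2]; simp
    intro x N hN
    rw [List.length_cons] at hN
    by_cases h : a = x
    · subst h; exact key N (by omega)
    · obtain ⟨N, rfl⟩ : ∃ M, N = M + 1 := ⟨N - 1, by omega⟩
      have hx : (!x) = a := by cases a <;> cases x <;> simp_all
      have hx' : (!a) = x := by cases a <;> cases x <;> simp_all
      have := key N (by omega)
      rw [Finset.sum_range_succ', Finset.sum_range_succ' (n := N + 1)]
      simp only [blockLength_zero_cons_of_ne h, blockLength_succ_cons_of_ne h, ite_self, add_zero,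
        Nat.even_add_one, Nat.odd_add_one, Nat.not_even_iff_odd, Nat.not_odd_iff_even]
      rw [hx, ← hx', this.1, this.2]
      simp

lemma count_ofFn {n : ℕ} (e : Fin n → Bool) (x : Bool) :
    (List.ofFn e).count x = (Finset.univ.filter (fun k => e k = x)).card := by
  induction n with
  | zero => simp
  | succ n ih =>
    rw [List.ofFn_succ, List.count_cons, ih, Finset.card_filter, Finset.card_filter,
      Fin.sum_univ_succ, add_comm]
    simp

lemma mem_pathTypes {p q : ℕ} {e : Fin (p + q) → Bool} :
    e ∈ pathTypes p q ↔ (Finset.univ.filter (fun k => e k = false)).card = p ∧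
      (Finset.univ.filter (fun k => e k = true)).card = q := by
  simp [pathTypes]

lemma sum_runLength {p q : ℕ} {e : Fin (p + q) → Bool} (he : e ∈ pathTypes p q) :
    ∑ j ∈ (Finset.range (p + q + 1)).filter Even, runLength e j = p ∧
    ∑ j ∈ (Finset.range (p + q + 1)).filter Odd, runLength e j = q := by
  rw [mem_pathTypes] at he
  have := sum_blockLength (List.ofFn e).reverse false (p + q) (by simp)
  simpa [runLength, List.count_reverse, count_ofFn, he] using this

lemma card_filter_true_add_false {n : ℕ} (e : Fin n → Bool) :
    (Finset.univ.filter (fun k => e k = false)).card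
      + (Finset.univ.filter (fun k => e k = true)).card = n := by
  have := Finset.card_filter_add_card_filter_not (s := (Finset.univ : Finset (Fin n)))
    (fun k => e k = false)
  simpa using this

lemma card_pathTypes (p q : ℕ) : (pathTypes p q).card = (p + q).choose p := by
  have : (Finset.powersetCard p (Finset.univ : Finset (Fin (p + q)))).card = (p + q).choose p := by
    simp
  rw [← this]
  refine Finset.card_bij' (fun e _ => Finset.univ.filter (fun k => e k = false))
    (fun s _ k => decide (k ∉ s)) ?_ ?_ ?_ ?_
  · intro e he
    simpa [Finset.mem_powersetCard] using (mem_pathTypes.1 he).1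
  · intro s hs
    rw [Finset.mem_powersetCard] at hs
    have h := card_filter_true_add_false (fun k => decide (k ∉ s))
    rw [mem_pathTypes]
    have h1 : (Finset.univ.filter (fun k => decide (k ∉ s) = false)).card = p := by
      refine Eq.trans ?_ hs.2; congr 1; ext; simp
    exact ⟨h1, by omega⟩
  · intro e _; ext k; simp
  · intro s _; ext k; simp

lemma pathWeight_pos {b c : ℝ} (hb : 0 < b) (hbc : b < c) {n : ℕ} (e : Fin n → Bool) :
    0 < pathWeight b c e := by
  refine Finset.prod_pos fun j _ => ?_
  have : 0 ≤ (j : ℝ) * (c - b) := by have := sub_pos.2 hbc; positivity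
  positivity

/-- Each `b_j` is at least `b`, and at least `b_1 = c` when `j` is odd; the run lengths of the two
parities add up to `p` and `q`. -/
lemma pathWeight_le {b c : ℝ} (hb : 0 < b) (hbc : b < c) {p q : ℕ} {e : Fin (p + q) → Bool}
    (he : e ∈ pathTypes p q) : pathWeight b c e ≤ (1 / b) ^ p * (1 / c) ^ q := by
  have hc : 0 < c := hb.trans hbc
  have hs := sum_runLength he
  have h : pathWeight b c e ≤ ∏ j ∈ Finset.range (p + q + 1),
      ((if Even j then (1 / b) ^ runLength e j else 1) *
        (if Odd j then (1 / c) ^ runLength e j else 1)) := by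
    have h0 := sub_pos.2 hbc
    refine Finset.prod_le_prod (fun j _ => by positivity) fun j _ => ?_
    rcases Nat.even_or_odd j with hj | hj
    · rw [if_pos hj, if_neg (Nat.not_odd_iff_even.2 hj), mul_one]
      gcongr
      have : 0 ≤ (j : ℝ) * (c - b) := by positivity
      linarith
    · rw [if_pos hj, if_neg (Nat.not_even_iff_odd.2 hj), one_mul]
      gcongr
      have : (1 : ℝ) ≤ j := by exact_mod_cast hj.pos
      nlinarith
  refine h.trans_eq ?_
  rw [Finset.prod_mul_distrib, ← Finset.prod_filter, ← Finset.prod_filter,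
    Finset.prod_pow_eq_pow_sum, Finset.prod_pow_eq_pow_sum, hs.1, hs.2]

/-- The word made of `p` letters `b` followed by `q` letters `c`. -/
def sortedWord (p q : ℕ) : Fin (p + q) → Bool := Fin.append (fun _ => false) (fun _ => true)

lemma card_sortedWord_false (p q : ℕ) :
    (Finset.univ.filter (fun k => sortedWord p q k = false)).card = p := by
  rw [Finset.card_filter, Fin.sum_univ_add]; simp [sortedWord]

lemma card_sortedWord_true (p q : ℕ) :
    (Finset.univ.filter (fun k => sortedWord p q k = true)).card = q := by
  rw [Finset.card_filter, Fin.sum_univ_add]; simp [sortedWord]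

/-- Orbit and stabilizer: the words in question form the orbit of the sorted word under permutation
of positions, and its stabilizer permutes the two groups of positions separately. -/
lemma sum_perm_sortedWord {p q : ℕ} (F : (Fin (p + q) → Bool) → ℝ) :
    ∑ σ : Equiv.Perm (Fin (p + q)), F (sortedWord p q ∘ σ)
      = (p ! : ℝ) * (q ! : ℝ) * ∑ e ∈ pathTypes p q, F e := by
  classical
  have hcomp : ∀ (σ : Equiv.Perm (Fin (p + q))) (x : Bool),
      (Finset.univ.filter (fun k => (sortedWord p q ∘ σ) k = x)).card
        = (Finset.univ.filter (fun k => sortedWord p q k = x)).card := fun σ x =>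
    Finset.card_equiv σ (by simp)
  have hmaps : ∀ σ ∈ (Finset.univ : Finset (Equiv.Perm (Fin (p + q)))),
      sortedWord p q ∘ σ ∈ pathTypes p q := by
    intro σ _
    rw [mem_pathTypes, hcomp, hcomp, card_sortedWord_false, card_sortedWord_true]
    exact ⟨rfl, rfl⟩
  rw [← Finset.sum_fiberwise_of_maps_to hmaps, Finset.mul_sum]
  refine Finset.sum_congr rfl fun e he => ?_
  rw [Finset.sum_congr rfl (g := fun _ => F e)
    (fun σ hσ => by rw [(Finset.mem_filter.1 hσ).2]), Finset.sum_const, nsmul_eq_mul]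
  congr 1
  have hfib : ∀ x : Bool, Nonempty ({k // e k = x} ≃ {k // sortedWord p q k = x}) := by
    intro x
    refine Fintype.card_eq.1 ?_
    rw [Fintype.card_subtype, Fintype.card_subtype]
    rw [mem_pathTypes] at he
    cases x
    · rw [he.1, card_sortedWord_false]
    · rw [he.2, card_sortedWord_true]
  -- Gluing bijections between the fibres over the two letters gives a permutation taking the sorted
  -- word to `e`; translating by its inverse identifies the permutations producing `e` with the
  -- stabilizer.
  have f := fun x => (hfib x).some
  let σ₀ : Equiv.Perm (Fin (p + q)) := Equiv.ofFiberEquiv f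
  have hσ₀ : sortedWord p q ∘ σ₀ = e := funext fun k => Equiv.ofFiberEquiv_map f k
  have hcard : (Finset.univ.filter (fun σ : Equiv.Perm (Fin (p + q)) =>
      sortedWord p q ∘ σ = e)).card = (Finset.univ.filter (fun σ : Equiv.Perm (Fin (p + q)) =>
      sortedWord p q ∘ σ = sortedWord p q)).card := by
    refine Finset.card_equiv (Equiv.mulRight σ₀⁻¹) fun σ => ?_
    simp only [Finset.mem_filter, Finset.mem_univ, true_and, Equiv.coe_mulRight,
      Equiv.Perm.coe_mul, ← Function.comp_assoc]
    rw [← hσ₀]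
    constructor
    · intro h; rw [h, Function.comp_assoc, ← Equiv.Perm.coe_mul]; simp
    · intro h
      funext k
      simpa using congrFun h (σ₀ k)
  rw [hcard, ← Fintype.card_subtype, DomMulAct.stabilizer_card]
  simp [Fintype.card_subtype, card_sortedWord_false, card_sortedWord_true, mul_comm]

end Words

/-! ### A drifted Gaussian integral over time -/

section TimeIntegral

lemma hasDerivAt_cdf_gaussianReal (x : ℝ) :
    HasDerivAt (cdf (gaussianReal 0 1)) (gaussianPDFReal 0 1 x) x := by
  have hcont : Continuous (gaussianPDFReal 0 1) := by
    unfold gaussianPDFReal; fun_prop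
  have hint := integrable_gaussianPDFReal 0 1
  have h : ∀ y, cdf (gaussianReal 0 1) y
      = cdf (gaussianReal 0 1) 0 + ∫ u in (0 : ℝ)..y, gaussianPDFReal 0 1 u := by
    have hy : ∀ y, cdf (gaussianReal 0 1) y = ∫ u in Set.Iic y, gaussianPDFReal 0 1 u := by
      intro y
      rw [cdf_eq_real, Measure.real, gaussianReal_apply_eq_integral _ one_ne_zero,
        ENNReal.toReal_ofReal]
      exact setIntegral_nonneg measurableSet_Iic fun u _ => gaussianPDFReal_nonneg _ _ _
    intro y
    rw [hy, hy, ← intervalIntegral.integral_Iic_sub_Iic hint.integrableOn hint.integrableOn]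
    ring
  rw [funext h]
  exact (hcont.integral_hasStrictDerivAt 0 x).hasDerivAt.const_add _

/-- Completing the square, each normal density times its exponential prefactor is the same function
of `τ`. The derivatives of the two arguments share the term in `z`, which cancels, and differ by `m
/ √τ`. -/
lemma hasDerivAt_timePrimitive {m z τ : ℝ} (hm : 0 < m) (hτ : 0 < τ) :
    HasDerivAt (fun τ => 1 / m *
        (Real.exp (-(m * z)) * cdf (gaussianReal 0 1) (m * √τ - z * (√τ)⁻¹)
          - Real.exp (m * z) * cdf (gaussianReal 0 1) (-(m * √τ) - z * (√τ)⁻¹)))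
      ((√(2 * Real.pi * τ))⁻¹ * Real.exp (-(z ^ 2 / (2 * τ)) - m ^ 2 * τ / 2)) τ := by
  have hr : 0 < √τ := Real.sqrt_pos.2 hτ
  have hsq : √τ ^ 2 = τ := Real.sq_sqrt hτ.le
  have hri : √τ * (√τ)⁻¹ = 1 := mul_inv_cancel₀ hr.ne'
  have hii : (√τ)⁻¹ ^ 2 = τ⁻¹ := by rw [inv_pow, hsq]
  have h1 : HasDerivAt (fun τ : ℝ => √τ) (1 / (2 * √τ)) τ := Real.hasDerivAt_sqrt hτ.ne'
  have h2 : HasDerivAt (fun τ : ℝ => (√τ)⁻¹) (-(1 / (2 * √τ)) / √τ ^ 2) τ := h1.inv hr.ne'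
  have hx := (h1.const_mul m).sub (h2.const_mul z)
  have hy := (h1.const_mul m).neg.sub (h2.const_mul z)
  have hX := (hasDerivAt_cdf_gaussianReal (m * √τ - z * (√τ)⁻¹)).comp τ hx
  have hY := (hasDerivAt_cdf_gaussianReal (-(m * √τ) - z * (√τ)⁻¹)).comp τ hy
  have hF := ((hX.const_mul (Real.exp (-(m * z)))).sub
    (hY.const_mul (Real.exp (m * z)))).const_mul (1 / m)
  refine hF.congr_deriv ?_
  have e1 : Real.exp (-(m * z)) * gaussianPDFReal 0 1 (m * √τ - z * (√τ)⁻¹)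
      = (√(2 * Real.pi))⁻¹ * Real.exp (-(z ^ 2 / (2 * τ)) - m ^ 2 * τ / 2) := by
    rw [gaussianPDFReal]
    rw [mul_left_comm, ← Real.exp_add]
    simp only [NNReal.coe_one, mul_one]
    congr 2
    linear_combination (-m ^ 2 / 2) * hsq + m * z * hri - z ^ 2 / 2 * hii
  have e2 : Real.exp (m * z) * gaussianPDFReal 0 1 (-(m * √τ) - z * (√τ)⁻¹)
      = (√(2 * Real.pi))⁻¹ * Real.exp (-(z ^ 2 / (2 * τ)) - m ^ 2 * τ / 2) := by
    rw [gaussianPDFReal]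
    rw [mul_left_comm, ← Real.exp_add]
    simp only [NNReal.coe_one, mul_one]
    congr 2
    linear_combination (-m ^ 2 / 2) * hsq - m * z * hri - z ^ 2 / 2 * hii
  rw [← mul_assoc, ← mul_assoc, e1, e2, Real.sqrt_mul (show 0 ≤ 2 * Real.pi by positivity) τ, mul_inv]
  field_simp
  ring

lemma tendsto_timePrimitive_atTop {m z : ℝ} (hm : 0 < m) :
    Tendsto (fun τ => 1 / m *
        (Real.exp (-(m * z)) * cdf (gaussianReal 0 1) (m * √τ - z * (√τ)⁻¹)
          - Real.exp (m * z) * cdf (gaussianReal 0 1) (-(m * √τ) - z * (√τ)⁻¹)))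
      atTop (𝓝 (1 / m * Real.exp (-(m * z)))) := by
  have hs : Tendsto (fun τ : ℝ => √τ) atTop atTop := Real.tendsto_sqrt_atTop
  have hi : Tendsto (fun τ : ℝ => z * (√τ)⁻¹) atTop (𝓝 0) := by
    simpa using (tendsto_inv_atTop_zero.comp hs).const_mul z
  have hms : Tendsto (fun τ : ℝ => m * √τ) atTop atTop := hs.const_mul_atTop hm
  have h1 : Tendsto (fun τ : ℝ => m * √τ - z * (√τ)⁻¹) atTop atTop := by
    simpa [sub_eq_add_neg] using tendsto_atTop_add_right_of_le' _ (-1) hms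
      ((hi.neg.eventually (lt_mem_nhds (a := -1) (by simp))).mono fun _ h => h.le)
  have h2 : Tendsto (fun τ : ℝ => -(m * √τ) - z * (√τ)⁻¹) atTop atBot := by
    have : Tendsto (fun τ : ℝ => m * √τ + z * (√τ)⁻¹) atTop atTop :=
      tendsto_atTop_add_right_of_le' _ (-1) hms
        ((hi.eventually (lt_mem_nhds (a := -1) (by simp))).mono fun _ h => h.le)
    refine (tendsto_neg_atTop_atBot.comp this).congr fun τ => ?_
    simp only [Function.comp]; ring
  have k1 := ((tendsto_cdf_atTop (gaussianReal 0 1)).comp h1).const_mul (Real.exp (-(m * z)))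
  have k2 := ((tendsto_cdf_atBot (gaussianReal 0 1)).comp h2).const_mul (Real.exp (m * z))
  simpa using (k1.sub k2).const_mul (1 / m)

/-- For `z > 0` both arguments tend to `-∞`; for `z = 0` both tend to `0` and the two values of the
distribution function cancel. For `z < 0` the limit would not vanish. -/
lemma tendsto_timePrimitive_zero {m z : ℝ} (hz : 0 ≤ z) :
    Tendsto (fun τ => 1 / m *
        (Real.exp (-(m * z)) * cdf (gaussianReal 0 1) (m * √τ - z * (√τ)⁻¹)
          - Real.exp (m * z) * cdf (gaussianReal 0 1) (-(m * √τ) - z * (√τ)⁻¹)))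
      (𝓝[>] 0) (𝓝 0) := by
  have hs0 : Tendsto (fun τ : ℝ => √τ) (𝓝[>] 0) (𝓝 0) := by
    have := (Real.continuous_sqrt.tendsto 0).mono_left (nhdsWithin_le_nhds (s := Set.Ioi 0))
    simpa using this
  have hms : Tendsto (fun τ : ℝ => m * √τ) (𝓝[>] 0) (𝓝 0) := by simpa using hs0.const_mul m
  rcases hz.eq_or_lt with rfl | hz
  · have hc : Continuous (cdf (gaussianReal 0 1)) :=
      continuous_iff_continuousAt.2 fun x => (hasDerivAt_cdf_gaussianReal x).continuousAt
    have k1 := (hc.tendsto 0).comp hms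
    have k2 := (hc.tendsto 0).comp (by simpa using hms.neg)
    simpa [Function.comp_def] using (k1.sub k2).const_mul (1 / m)
  · have hs : Tendsto (fun τ : ℝ => √τ) (𝓝[>] 0) (𝓝[>] 0) :=
      tendsto_nhdsWithin_iff.2 ⟨hs0, eventually_mem_nhdsWithin.mono fun τ h => Real.sqrt_pos.2 h⟩
    have hi : Tendsto (fun τ : ℝ => z * (√τ)⁻¹) (𝓝[>] 0) atTop :=
      (tendsto_inv_nhdsGT_zero.comp hs).const_mul_atTop hz
    have h1 : Tendsto (fun τ : ℝ => m * √τ - z * (√τ)⁻¹) (𝓝[>] 0) atBot := by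
      simpa [sub_eq_add_neg] using hms.add_atBot (tendsto_neg_atTop_atBot.comp hi)
    have h2 : Tendsto (fun τ : ℝ => -(m * √τ) - z * (√τ)⁻¹) (𝓝[>] 0) atBot := by
      simpa [sub_eq_add_neg] using hms.neg.add_atBot (tendsto_neg_atTop_atBot.comp hi)
    have k1 := ((tendsto_cdf_atBot (gaussianReal 0 1)).comp h1).const_mul (Real.exp (-(m * z)))
    have k2 := ((tendsto_cdf_atBot (gaussianReal 0 1)).comp h2).const_mul (Real.exp (m * z))
    simpa using (k1.sub k2).const_mul (1 / m)

lemma lintegral_timeKernel_of_nonneg {m z : ℝ} (hm : 0 < m) (hz : 0 ≤ z) :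
    ∫⁻ τ in Set.Ioi (0 : ℝ), ENNReal.ofReal
        ((√(2 * Real.pi * τ))⁻¹ * Real.exp (-(z ^ 2 / (2 * τ)) - m ^ 2 * τ / 2))
      = ENNReal.ofReal (1 / m * Real.exp (-(m * z))) := by
  set F : ℝ → ℝ := fun τ => 1 / m *
        (Real.exp (-(m * z)) * cdf (gaussianReal 0 1) (m * √τ - z * (√τ)⁻¹)
          - Real.exp (m * z) * cdf (gaussianReal 0 1) (-(m * √τ) - z * (√τ)⁻¹)) with hF
  -- Since `(√0)⁻¹ = 0` by convention, `F 0` is in general not the limit of `F` at `0`; the value is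
  -- corrected to obtain continuity there.
  set G : ℝ → ℝ := Function.update F 0 0 with hG
  have hGF : ∀ τ, 0 < τ → G =ᶠ[𝓝 τ] F := fun τ hτ => by
    filter_upwards [lt_mem_nhds hτ] with x hx
    simp [hG, Function.update_of_ne hx.ne']
  have hcont : ContinuousWithinAt G (Set.Ici 0) 0 := by
    rw [hG, continuousWithinAt_update_same]
    rw [Set.Ici_sdiff_left]
    exact tendsto_timePrimitive_zero hz
  have hderiv : ∀ τ ∈ Set.Ioi (0 : ℝ), HasDerivAt G
      ((√(2 * Real.pi * τ))⁻¹ * Real.exp (-(z ^ 2 / (2 * τ)) - m ^ 2 * τ / 2)) τ :=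
    fun τ hτ => (hasDerivAt_timePrimitive hm hτ).congr_of_eventuallyEq (hGF τ hτ)
  have hpos : ∀ τ ∈ Set.Ioi (0 : ℝ),
      0 ≤ (√(2 * Real.pi * τ))⁻¹ * Real.exp (-(z ^ 2 / (2 * τ)) - m ^ 2 * τ / 2) :=
    fun τ _ => by positivity
  have htop : Tendsto G atTop (𝓝 (1 / m * Real.exp (-(m * z)))) := by
    refine (tendsto_timePrimitive_atTop hm).congr' ?_
    filter_upwards [eventually_gt_atTop 0] with τ hτ
    exact ((hGF τ hτ).eq_of_nhds).symm
  rw [← ofReal_integral_eq_lintegral_ofReal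
    (integrableOn_Ioi_deriv_of_nonneg hcont hderiv hpos htop)
    ((ae_restrict_iff' measurableSet_Ioi).2 (ae_of_all _ hpos)),
    integral_Ioi_of_hasDerivAt_of_nonneg hcont hderiv hpos htop]
  simp [hG]

lemma lintegral_timeKernel {m : ℝ} (hm : 0 < m) (z : ℝ) :
    ∫⁻ τ in Set.Ioi (0 : ℝ), ENNReal.ofReal
        ((√(2 * Real.pi * τ))⁻¹ * Real.exp (-(z ^ 2 / (2 * τ)) - m ^ 2 * τ / 2))
      = ENNReal.ofReal (1 / m * Real.exp (-(m * |z|))) := by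
  simpa using lintegral_timeKernel_of_nonneg hm (abs_nonneg z)

lemma setLIntegral_Ioi_eq_add (f : ℝ → ENNReal) (a : ℝ) :
    ∫⁻ s in Set.Ioi a, f s = ∫⁻ τ in Set.Ioi (0 : ℝ), f (a + τ) := by
  rw [← lintegral_indicator measurableSet_Ioi, ← lintegral_indicator measurableSet_Ioi,
    ← lintegral_add_left_eq_self _ a]
  refine lintegral_congr fun τ => ?_
  simp [Set.indicator_apply]

/-- With `s = t + τ` the increment is `(a - v) t + a τ`. Expanding its square leaves the kernel of
`lintegral_timeKernel` with `z = (a - v) t`, and `m²` collects the terms linear in `τ`. -/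
lemma lintegral_gaussianPDFReal_ray {a v m lam t : ℝ} (hm : 0 < m) (hlam : m ^ 2 = a ^ 2 + 2 * lam)
    (ht : 0 ≤ t) :
    ∫⁻ s in Set.Ioi t, ENNReal.ofReal
        (gaussianPDFReal 0 (s - t).toNNReal (a * s - v * t) * Real.exp (-(lam * s)))
      = ENNReal.ofReal (1 / m * Real.exp (-((lam + a * (a - v) + m * |a - v|) * t))) := by
  rw [setLIntegral_Ioi_eq_add]
  have h : ∀ τ ∈ Set.Ioi (0 : ℝ), ENNReal.ofReal
        (gaussianPDFReal 0 (t + τ - t).toNNReal (a * (t + τ) - v * t)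
          * Real.exp (-(lam * (t + τ))))
      = ENNReal.ofReal (Real.exp (-((lam + a * (a - v)) * t))) * ENNReal.ofReal
        ((√(2 * Real.pi * τ))⁻¹ * Real.exp (-(((a - v) * t) ^ 2 / (2 * τ)) - m ^ 2 * τ / 2)) := by
    intro τ hτ
    have hτ0 : (0 : ℝ) < τ := hτ
    rw [← ENNReal.ofReal_mul (Real.exp_pos _).le]
    congr 1
    rw [gaussianPDFReal, add_sub_cancel_left, Real.coe_toNNReal _ hτ0.le, mul_left_comm,
      mul_assoc, ← Real.exp_add, ← Real.exp_add]
    congr 2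
    rw [hlam]
    field_simp
    ring
  rw [setLIntegral_congr_fun measurableSet_Ioi h, lintegral_const_mul' _ _ ENNReal.ofReal_ne_top,
    lintegral_timeKernel hm, ← ENNReal.ofReal_mul (Real.exp_pos _).le, mul_left_comm,
    ← Real.exp_add, abs_mul, abs_of_nonneg ht]
  congr 3
  ring

end TimeIntegral

/-! ### Ordered times and the Brownian density -/

section Ordered

/-- The last entry of a tuple, `0` for the empty tuple. -/
def lastEntry {n : ℕ} (t : Fin n → ℝ) : ℝ := (Fin.cons 0 t : Fin (n + 1) → ℝ) (Fin.last n)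

@[simp] lemma lastEntry_zero (t : Fin 0 → ℝ) : lastEntry t = 0 := rfl

lemma lastEntry_succ {n : ℕ} (t : Fin (n + 1) → ℝ) : lastEntry t = t (Fin.last n) := by
  rw [lastEntry, ← Fin.succ_last, Fin.cons_succ]

@[simp] lemma lastEntry_snoc {n : ℕ} (t : Fin n → ℝ) (s : ℝ) :
    lastEntry (Fin.snoc t s : Fin (n + 1) → ℝ) = s := by
  rw [lastEntry_succ, Fin.snoc_last]

@[fun_prop]
lemma measurable_lastEntry {n : ℕ} : Measurable (lastEntry : (Fin n → ℝ) → ℝ) := by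
  cases n with
  | zero => exact measurable_const
  | succ n => simp only [funext lastEntry_succ]; fun_prop

lemma cons_snoc_castSucc {n : ℕ} (t : Fin n → ℝ) (s : ℝ) (i : Fin (n + 1)) :
    (Fin.cons 0 (Fin.snoc t s : Fin (n + 1) → ℝ) : Fin (n + 2) → ℝ) i.castSucc
      = (Fin.cons 0 t : Fin (n + 1) → ℝ) i := by
  refine Fin.cases ?_ (fun j => ?_) i
  · simp
  · rw [Fin.castSucc_succ, Fin.cons_succ, Fin.cons_succ, Fin.snoc_castSucc]

lemma brownianDensity_snoc {n : ℕ} (t x : Fin n → ℝ) (s y : ℝ) :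
    brownianDensity (Fin.snoc t s : Fin (n + 1) → ℝ) (Fin.snoc x y)
      = brownianDensity t x * gaussianPDFReal 0 (s - lastEntry t).toNNReal (y - lastEntry x) := by
  rw [brownianDensity, Fin.prod_univ_castSucc]
  congr 1
  · refine Finset.prod_congr rfl fun i _ => ?_
    rw [Fin.succ_castSucc, cons_snoc_castSucc, cons_snoc_castSucc, cons_snoc_castSucc,
      cons_snoc_castSucc]
  · rw [cons_snoc_castSucc, cons_snoc_castSucc, Fin.cons_succ, Fin.cons_succ, Fin.snoc_last,
      Fin.snoc_last]
    rfl

lemma brownianDensity_nonneg {n : ℕ} (t x : Fin n → ℝ) : 0 ≤ brownianDensity t x :=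
  Finset.prod_nonneg fun _ _ => gaussianPDFReal_nonneg _ _ _

lemma measurable_brownianDensity {n : ℕ} :
    Measurable (fun p : (Fin n → ℝ) × (Fin n → ℝ) => brownianDensity p.1 p.2) := by
  have hc : ∀ i : Fin (n + 1),
      Measurable (fun x : Fin n → ℝ => (Fin.cons 0 x : Fin (n + 1) → ℝ) i) := by
    intro i
    refine Fin.cases ?_ (fun j => ?_) i
    · simp
    · simpa using measurable_pi_apply j
  refine Finset.measurable_prod _ fun i _ => ?_
  have h : Measurable (fun p : (Fin n → ℝ) × (Fin n → ℝ) => ((0 : ℝ),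
      ((Fin.cons 0 p.1 : Fin (n + 1) → ℝ) i.succ
        - (Fin.cons 0 p.1 : Fin (n + 1) → ℝ) i.castSucc).toNNReal,
      (Fin.cons 0 p.2 : Fin (n + 1) → ℝ) i.succ
        - (Fin.cons 0 p.2 : Fin (n + 1) → ℝ) i.castSucc)) := by
    refine measurable_const.prodMk (Measurable.prodMk ?_ ?_)
    · exact (((hc _).comp measurable_fst).sub ((hc _).comp measurable_fst)).real_toNNReal
    · exact ((hc _).comp measurable_snd).sub ((hc _).comp measurable_snd)
  exact measurable_uncurry_gaussianPDFReal.comp h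

lemma mem_orderedTimes_iff {n : ℕ} {t : Fin n → ℝ} : t ∈ orderedTimes n ↔
    ∀ i : Fin n, (Fin.cons 0 t : Fin (n + 1) → ℝ) i.castSucc
      < (Fin.cons 0 t : Fin (n + 1) → ℝ) i.succ := by
  rw [← Fin.strictMono_iff_lt_succ]
  constructor
  · rintro ⟨h0, h1⟩ i j hij
    induction i using Fin.cases with
    | zero =>
      induction j using Fin.cases with
      | zero => exact absurd hij (lt_irrefl _)
      | succ j => simpa using h0 j
    | succ i =>
      induction j using Fin.cases with
      | zero => exact absurd hij (Fin.not_lt_zero _)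
      | succ j => simpa using h1 (Fin.succ_lt_succ_iff.1 hij)
  · intro h
    refine ⟨fun i => by simpa using h (Fin.succ_pos i), fun i j hij => ?_⟩
    simpa using h (Fin.succ_lt_succ_iff.2 hij)

lemma snoc_mem_orderedTimes_iff {n : ℕ} {t : Fin n → ℝ} {s : ℝ} :
    (Fin.snoc t s : Fin (n + 1) → ℝ) ∈ orderedTimes (n + 1)
      ↔ t ∈ orderedTimes n ∧ lastEntry t < s := by
  rw [mem_orderedTimes_iff, mem_orderedTimes_iff, Fin.forall_fin_succ']
  simp only [Fin.succ_castSucc, cons_snoc_castSucc, Fin.cons_succ, Fin.snoc_last]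
  rfl

lemma lastEntry_nonneg {n : ℕ} {t : Fin n → ℝ} (ht : t ∈ orderedTimes n) : 0 ≤ lastEntry t := by
  cases n with
  | zero => simp
  | succ n => rw [lastEntry_succ]; exact (ht.1 _).le

lemma measurableSet_orderedTimes (n : ℕ) : MeasurableSet (orderedTimes n) := by
  induction n with
  | zero =>
    convert MeasurableSet.univ (α := Fin 0 → ℝ)
    ext t
    simp [mem_orderedTimes_iff]
  | succ n ih =>
    have : orderedTimes (n + 1) = {t | (Fin.init t : Fin n → ℝ) ∈ orderedTimes n}
        ∩ {t | lastEntry (Fin.init t : Fin n → ℝ) < t (Fin.last n)} := by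
      ext t
      rw [← Fin.snoc_init_self t, snoc_mem_orderedTimes_iff]
      simp
    rw [this]
    have hi : Measurable (fun t : Fin (n + 1) → ℝ => (Fin.init t : Fin n → ℝ)) :=
      measurable_pi_lambda _ fun i => measurable_pi_apply _
    exact (hi ih).inter (measurableSet_lt (measurable_lastEntry.comp hi) (measurable_pi_apply _))

lemma measurable_snoc {n : ℕ} :
    Measurable (fun p : (Fin n → ℝ) × ℝ => (Fin.snoc p.1 p.2 : Fin (n + 1) → ℝ)) := by
  refine measurable_pi_lambda _ fun i => ?_
  refine Fin.lastCases ?_ (fun j => ?_) i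
  · simpa using measurable_snd
  · simpa [Function.comp_def] using (measurable_pi_apply j).comp measurable_fst

lemma lintegral_fin_succ {n : ℕ} {F : (Fin (n + 1) → ℝ) → ENNReal} (hF : Measurable F) :
    ∫⁻ t, F t = ∫⁻ t : Fin n → ℝ, ∫⁻ s : ℝ, F (Fin.snoc t s) := by
  have h := (volume_preserving_piFinSuccAbove (fun _ : Fin (n + 1) => ℝ) (Fin.last n)).symm
  rw [← h.lintegral_comp hF, Measure.volume_eq_prod, lintegral_prod_symm
    (fun a => F ((MeasurableEquiv.piFinSuccAbove (fun _ => ℝ) (Fin.last n)).symm a))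
    (hF.comp (MeasurableEquiv.measurable _)).aemeasurable]
  refine lintegral_congr fun t => lintegral_congr fun s => ?_
  congr 1
  exact Fin.insertNth_last' s t

lemma lintegral_orderedTimes_succ {n : ℕ} {F : (Fin (n + 1) → ℝ) → ENNReal} (hF : Measurable F) :
    ∫⁻ t in orderedTimes (n + 1), F t
      = ∫⁻ t in orderedTimes n, ∫⁻ s in Set.Ioi (lastEntry t), F (Fin.snoc t s) := by
  rw [← lintegral_indicator (measurableSet_orderedTimes _),
    lintegral_fin_succ (hF.indicator (measurableSet_orderedTimes _)),
    ← lintegral_indicator (measurableSet_orderedTimes _)]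
  refine lintegral_congr fun t => ?_
  by_cases ht : t ∈ orderedTimes n
  · rw [Set.indicator_of_mem ht, ← lintegral_indicator measurableSet_Ioi]
    refine lintegral_congr fun s => ?_
    by_cases hs : lastEntry t < s
    · rw [Set.indicator_of_mem (snoc_mem_orderedTimes_iff.2 ⟨ht, hs⟩),
        Set.indicator_of_mem (Set.mem_Ioi.2 hs)]
    · rw [Set.indicator_of_notMem (fun h => hs (snoc_mem_orderedTimes_iff.1 h).2),
        Set.indicator_of_notMem (show s ∉ Set.Ioi (lastEntry t) from hs)]
  · rw [Set.indicator_of_notMem ht]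
    refine (lintegral_congr fun s => ?_).trans lintegral_zero
    rw [Set.indicator_of_notMem (fun h => ht (snoc_mem_orderedTimes_iff.1 h).1)]

lemma snoc_ray {n : ℕ} (v : Fin (n + 1) → ℝ) (t : Fin n → ℝ) (s : ℝ) :
    (fun k => v k * (Fin.snoc t s : Fin (n + 1) → ℝ) k)
      = Fin.snoc (fun k => Fin.init v k * t k) (v (Fin.last n) * s) := by
  funext k
  refine Fin.lastCases ?_ (fun j => ?_) k
  · simp
  · simp [Fin.init]

lemma lastEntry_ray {n : ℕ} (v t : Fin n → ℝ) :
    lastEntry (fun k => v k * t k) = lastEntry v * lastEntry t := by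
  cases n with
  | zero => simp
  | succ n => simp [lastEntry_succ]

lemma Measurable.comp_graph {α β γ : Type*} [MeasurableSpace α] [MeasurableSpace β]
    [MeasurableSpace γ] {D : α → β → γ} (hD : Measurable (fun p : α × β => D p.1 p.2))
    {g : α → β} (hg : Measurable g) : Measurable (fun a => D a (g a)) :=
  hD.comp (measurable_id.prodMk hg)

lemma measurable_brownianDensity_ray {n : ℕ} (v y : Fin n → ℝ) :
    Measurable (fun t => brownianDensity t (fun k => v k * t k + y k)) := by
  have h : Measurable (fun (t : Fin n → ℝ) k => v k * t k + y k) := by fun_prop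
  exact Measurable.comp_graph (D := brownianDensity) measurable_brownianDensity h

end Ordered

/-! ### The contribution of a single word -/

section SingleWord

lemma raySlope_pos {b c : ℝ} (hb : 0 < b) (hbc : b < c) (x : Bool) : 0 < raySlope b c x := by
  cases x <;> simp [raySlope, hb, hb.trans hbc]

/-- The rate of decay in time of the mass contributed by the blocks read so far, when the current
letter is `a` in block number `j`. -/
noncomputable def blockRate (b c : ℝ) (j : ℕ) (a : Bool) : ℝ :=
  ((b + (j : ℝ) * (c - b)) ^ 2 - raySlope b c a ^ 2) / 2

/-- The left side is `((b_j + |a - v|)² - v²) / 2`, writing `a`, `v` for the slopes, and `|a - v|`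
is `0` or `c - b`. -/
lemma blockRate_step {b c : ℝ} (hbc : b < c) (j : ℕ) (a v : Bool) :
    blockRate b c j a + raySlope b c a * (raySlope b c a - raySlope b c v)
        + (b + (j : ℝ) * (c - b)) * |raySlope b c a - raySlope b c v|
      = blockRate b c (if v = a then j else j + 1) v := by
  have h := sub_pos.2 hbc
  cases a <;> cases v <;>
    simp [blockRate, raySlope, abs_of_pos h, abs_sub_comm b c] <;> ring

/-- The damping rate `r` is the induction variable: integrating out the last time contributes the
factor `1 / b_j` and turns `r` into the rate for the preceding letter. The empty word puts no
condition on `r`, because its last time is `0`. -/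
lemma lintegral_orderedTimes_word {b c : ℝ} (hb : 0 < b) (hbc : b < c) (n : ℕ) :
    ∀ (e : Fin n → Bool) (j : ℕ) (x : Bool) (r : ℝ),
      (∀ h : n ≠ 0, r = blockRate b c
        (if e ⟨n - 1, by omega⟩ = x then j else j + 1) (e ⟨n - 1, by omega⟩)) →
      ∫⁻ t in orderedTimes n, ENNReal.ofReal
        (brownianDensity t (fun k => raySlope b c (e k) * t k) * Real.exp (-(r * lastEntry t)))
      = ENNReal.ofReal (wordWeight b c j x (List.ofFn e).reverse) := by
  induction n with
  | zero =>
    intro e j x r _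
    have : orderedTimes 0 = Set.univ := by ext t; simp [mem_orderedTimes_iff]
    simp [this, brownianDensity, wordWeight, volume_pi]
  | succ n ih =>
    intro e j x r hr
    have hr' := hr (Nat.succ_ne_zero n)
    set a : Bool := e (Fin.last n) with ha
    replace hr' : r = blockRate b c (if a = x then j else j + 1) a := hr'
    set j' := if a = x then j else j + 1 with hj'
    set m : ℝ := b + (j' : ℝ) * (c - b) with hm
    have hm0 : 0 < m := by have := sub_pos.2 hbc; positivity
    rw [lintegral_orderedTimes_succ (by
      have := measurable_brownianDensity_ray (fun k => raySlope b c (e k)) 0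
      simp only [Pi.zero_apply, add_zero] at this
      fun_prop)]
    have hlist : (List.ofFn e).reverse = a :: (List.ofFn (Fin.init e : Fin n → Bool)).reverse := by
      rw [List.ofFn_succ', List.concat_eq_append, List.reverse_append]
      rfl
    set r' : ℝ := r + raySlope b c a * (raySlope b c a
        - lastEntry (fun k => raySlope b c (Fin.init e k : Bool)))
        + m * |raySlope b c a - lastEntry (fun k => raySlope b c (Fin.init e k : Bool))| with hr'def
    have hin : ∀ t ∈ orderedTimes n, ∫⁻ s in Set.Ioi (lastEntry t), ENNReal.ofReal
        (brownianDensity (Fin.snoc t s : Fin (n + 1) → ℝ)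
          (fun k => raySlope b c (e k) * (Fin.snoc t s : Fin (n + 1) → ℝ) k)
          * Real.exp (-(r * lastEntry (Fin.snoc t s : Fin (n + 1) → ℝ))))
        = ENNReal.ofReal (1 / m) * ENNReal.ofReal
          (brownianDensity t (fun k => raySlope b c (Fin.init e k : Bool) * t k)
            * Real.exp (-(r' * lastEntry t))) := by
      intro t ht
      have h1 : ∀ s, ENNReal.ofReal
        (brownianDensity (Fin.snoc t s : Fin (n + 1) → ℝ)
          (fun k => raySlope b c (e k) * (Fin.snoc t s : Fin (n + 1) → ℝ) k)
          * Real.exp (-(r * lastEntry (Fin.snoc t s : Fin (n + 1) → ℝ))))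
        = ENNReal.ofReal (brownianDensity t (fun k => raySlope b c (Fin.init e k : Bool) * t k))
          * ENNReal.ofReal (gaussianPDFReal 0 (s - lastEntry t).toNNReal (raySlope b c a * s
            - lastEntry (fun k => raySlope b c (Fin.init e k : Bool)) * lastEntry t)
            * Real.exp (-(r * s))) := by
        intro s
        rw [snoc_ray (fun k => raySlope b c (e k)), brownianDensity_snoc, lastEntry_snoc,
          ← ENNReal.ofReal_mul (brownianDensity_nonneg _ _), mul_assoc, lastEntry_ray]
        rfl
      simp only [h1]
      rw [lintegral_const_mul' _ _ ENNReal.ofReal_ne_top,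
        lintegral_gaussianPDFReal_ray hm0 (by rw [hr', blockRate]; ring) (lastEntry_nonneg ht),
        ← ENNReal.ofReal_mul (brownianDensity_nonneg _ _), ← ENNReal.ofReal_mul (by positivity)]
      congr 1
      ring
    rw [setLIntegral_congr_fun (measurableSet_orderedTimes n) hin,
      lintegral_const_mul' _ _ ENNReal.ofReal_ne_top,
      ih (Fin.init e) j' a r' ?_, hlist, wordWeight, ENNReal.ofReal_mul (by positivity)]
    intro hn
    obtain ⟨k, rfl⟩ := Nat.exists_eq_succ_of_ne_zero hn
    have := blockRate_step hbc j' a (Fin.init e (Fin.last k))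
    rw [hr'def, hr', lastEntry_succ, ← hm] at *
    exact this

lemma lintegral_brownianDensity_word {b c : ℝ} (hb : 0 < b) (hbc : b < c) {n : ℕ}
    (e : Fin n → Bool) :
    ∫⁻ t in orderedTimes n,
        ENNReal.ofReal (brownianDensity t (fun k => raySlope b c (e k) * t k))
      = ENNReal.ofReal (pathWeight b c e) := by
  rw [pathWeight_eq_wordWeight, ← lintegral_orderedTimes_word hb hbc n e 0 false 0]
  · simp
  -- The undamped integral fits both possible last letters: the rate vanishes for `b` in block `0`
  -- as `b_0 = b`, and for `c` in block `1` as `b_1 = c`.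
  · intro hn
    cases e ⟨n - 1, by omega⟩ <;> simp [blockRate, raySlope]

lemma integrableOn_brownianDensity_word {b c : ℝ} (hb : 0 < b) (hbc : b < c) {n : ℕ}
    (e : Fin n → Bool) :
    IntegrableOn (fun t => brownianDensity t (fun k => raySlope b c (e k) * t k))
      (orderedTimes n) := by
  have hm := measurable_brownianDensity_ray (fun k => raySlope b c (e k)) 0
  simp only [Pi.zero_apply, add_zero] at hm
  refine ⟨hm.aestronglyMeasurable, ?_⟩
  rw [hasFiniteIntegral_iff_ofReal (ae_of_all _ fun t => brownianDensity_nonneg _ _),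
    lintegral_brownianDensity_word hb hbc]
  exact ENNReal.ofReal_lt_top

lemma integral_brownianDensity_word {b c : ℝ} (hb : 0 < b) (hbc : b < c) {n : ℕ}
    (e : Fin n → Bool) :
    ∫ t in orderedTimes n, brownianDensity t (fun k => raySlope b c (e k) * t k)
      = pathWeight b c e := by
  rw [integral_eq_lintegral_of_nonneg_ae (ae_of_all _ fun t => brownianDensity_nonneg _ _)
    (integrableOn_brownianDensity_word hb hbc e).1, lintegral_brownianDensity_word hb hbc,
    ENNReal.toReal_ofReal (pathWeight_pos hb hbc e).le]

end SingleWord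

/-! ### Stability of the contribution of a word under shifts -/

section Shift

/-- The tangent-line bound `u² / (2τ) ≥ a u - a² τ / 2` replaces the square by a linear term. What
remains is a difference of `v² t / 2` and `a² (t + τ) / 2`, which telescopes along the word; the
spare term `(a - v)² t / 2` is dropped. -/
lemma exp_square_le {a v u τ t D : ℝ} (hτ : 0 < τ)
    (ht : 0 ≤ t) (hu : a * (a * (t + τ) - v * t) - D ≤ a * u) :
    -(u ^ 2 / (2 * τ)) ≤ D + (v ^ 2 * t - a ^ 2 * (t + τ)) / 2 := by
  have h1 : a * u - a ^ 2 * τ / 2 ≤ u ^ 2 / (2 * τ) := by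
    rw [le_div_iff₀ (by positivity)]
    nlinarith [sq_nonneg (u - a * τ)]
  nlinarith [mul_nonneg ht (sq_nonneg (a - v))]

/-- The bounds of `exp_square_le` telescope to an exponent depending only on the last slope and the
last time, which for the constant word `b` is exact. The Gaussian prefactors agree on both sides, so
the comparison is uniform in the shift. -/
lemma brownianDensity_shift_le {b c δ : ℝ} (hb : 0 < b) (hbc : b < c) (hδ : 0 ≤ δ) (n : ℕ) :
    ∀ (e : Fin n → Bool) (y t : Fin n → ℝ), (∀ k, |y k| ≤ δ) → t ∈ orderedTimes n →
      brownianDensity t (fun k => raySlope b c (e k) * t k + y k)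
        ≤ Real.exp (2 * c * δ * n) *
          Real.exp (-((lastEntry (fun k => raySlope b c (e k)) ^ 2 - b ^ 2) / 2 * lastEntry t)) *
          brownianDensity t (fun k => b * t k) := by
  induction n with
  | zero => intro e y t _ _; simp [brownianDensity]
  | succ n ih =>
    intro e y t hy ht
    obtain ⟨t, s, rfl⟩ : ∃ (t' : Fin n → ℝ) (s : ℝ), t = Fin.snoc t' s :=
      ⟨Fin.init t, t (Fin.last n), (Fin.snoc_init_self t).symm⟩
    rw [snoc_mem_orderedTimes_iff] at ht
    obtain ⟨ht, hs⟩ := ht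
    have ht0 := lastEntry_nonneg ht
    have hc : 0 < c := hb.trans hbc
    set a := raySlope b c (e (Fin.last n)) with ha
    have ha0 : 0 < a := raySlope_pos hb hbc _
    have hac : a ≤ c := by rw [ha]; cases e (Fin.last n) <;> simp [raySlope, hbc.le]
    set v := lastEntry (fun k => raySlope b c (Fin.init e k : Bool)) with hv
    have hx : (fun k => raySlope b c (e k) * (Fin.snoc t s : Fin (n + 1) → ℝ) k + y k)
        = Fin.snoc (fun k => raySlope b c (Fin.init e k : Bool) * t k + Fin.init y k)
          (a * s + y (Fin.last n)) := by
      funext k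
      refine Fin.lastCases ?_ (fun j => ?_) k
      · simp [ha]
      · simp [Fin.init]
    have hlast : lastEntry (fun k => raySlope b c (Fin.init e k : Bool) * t k + Fin.init y k)
        = v * lastEntry t + lastEntry (Fin.init y : Fin n → ℝ) := by
      rw [hv]
      cases n with
      | zero => simp
      | succ n => simp [lastEntry_succ]
    have hyl : |lastEntry (Fin.init y : Fin n → ℝ)| ≤ δ := by
      cases n with
      | zero => simpa using hδ
      | succ n => rw [lastEntry_succ]; exact hy _
    have hih := ih (Fin.init e) (Fin.init y) t (fun k => hy _) ht
    rw [hx, snoc_ray (fun _ => b), brownianDensity_snoc, brownianDensity_snoc, lastEntry_snoc,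
      lastEntry_succ, hlast, lastEntry_ray, ← ha]
    have hτ : 0 < s - lastEntry t := sub_pos.2 hs
    set τ := s - lastEntry t with hτdef
    have hsτ : s = lastEntry t + τ := by rw [hτdef]; ring
    have hlb : lastEntry (Fin.init (fun _ : Fin (n + 1) => b) : Fin n → ℝ) * lastEntry t = b * lastEntry t := by
      cases n with
      | zero => simp
      | succ n => simp [lastEntry_succ, Fin.init]
    rw [hlb]
    -- Both ends of the increment move by at most `δ` and the slope is at most `c`, hence the error
    -- `2 c δ` per factor.
    have hu := exp_square_le (a := a) (v := v) (τ := τ) (t := lastEntry t) (D := 2 * c * δ)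
      (u := a * s + y (Fin.last n) - (v * lastEntry t + lastEntry (Fin.init y : Fin n → ℝ)))
      hτ ht0 (by
        have h1 := abs_le.1 (hy (Fin.last n))
        have h2 := abs_le.1 hyl
        rw [← hsτ]
        nlinarith [mul_le_mul_of_nonneg_right hac hδ])
    have hg : gaussianPDFReal 0 τ.toNNReal (a * s + y (Fin.last n)
          - (v * lastEntry t + lastEntry (Fin.init y : Fin n → ℝ)))
        ≤ Real.exp (2 * c * δ) * Real.exp ((v ^ 2 - b ^ 2) / 2 * lastEntry t) *
          Real.exp (-((a ^ 2 - b ^ 2) / 2 * s)) *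
          gaussianPDFReal 0 τ.toNNReal (b * s - b * lastEntry t) := by
      rw [gaussianPDFReal, gaussianPDFReal, Real.coe_toNNReal _ hτ.le, mul_left_comm,
        ← Real.exp_add, ← Real.exp_add, ← Real.exp_add]
      refine mul_le_mul_of_nonneg_left (Real.exp_le_exp.2 ?_) (by positivity)
      have h3 : -(b * s - b * lastEntry t - 0) ^ 2 / (2 * τ) = -(b ^ 2 * τ / 2) := by
        rw [hsτ]; field_simp; ring
      rw [h3, sub_zero, neg_div]
      refine hu.trans (le_of_eq ?_)
      rw [hsτ]; ring
    calc _ ≤ (Real.exp (2 * c * δ * n) * Real.exp (-((v ^ 2 - b ^ 2) / 2 * lastEntry t)) *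
          brownianDensity t (fun k => b * t k)) * (Real.exp (2 * c * δ) *
          Real.exp ((v ^ 2 - b ^ 2) / 2 * lastEntry t) *
          Real.exp (-((a ^ 2 - b ^ 2) / 2 * s)) *
          gaussianPDFReal 0 τ.toNNReal (b * s - b * lastEntry t)) := by
            refine mul_le_mul hih hg (gaussianPDFReal_nonneg _ _ _) ?_
            have := brownianDensity_nonneg t (fun k => b * t k)
            positivity
      _ = _ := by
            have e1 : Real.exp (-((v ^ 2 - b ^ 2) / 2 * lastEntry t))
                * Real.exp ((v ^ 2 - b ^ 2) / 2 * lastEntry t) = 1 := by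
              rw [← Real.exp_add]; simp
            have e2 : Real.exp (2 * c * δ * ((n + 1 : ℕ) : ℝ))
                = Real.exp (2 * c * δ * n) * Real.exp (2 * c * δ) := by
              rw [← Real.exp_add]; congr 1; push_cast; ring
            rw [e2]
            simp only [Fin.init]
            linear_combination (Real.exp (2 * c * δ * n) * brownianDensity t (fun k => b * t k)
              * Real.exp (2 * c * δ) * Real.exp (-((a ^ 2 - b ^ 2) / 2 * s)) *
              gaussianPDFReal 0 τ.toNNReal (b * s - b * lastEntry t)) * e1

/-- The integral over the ordered times of the Brownian density at the points of the rays of a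
word, shifted by `y`. -/
noncomputable def shiftedWeight (b c : ℝ) {n : ℕ} (e : Fin n → Bool) (y : Fin n → ℝ) : ENNReal :=
  ∫⁻ t in orderedTimes n,
    ENNReal.ofReal (brownianDensity t (fun k => raySlope b c (e k) * t k + y k))

lemma shiftedWeight_zero {b c : ℝ} (hb : 0 < b) (hbc : b < c) {n : ℕ} (e : Fin n → Bool) :
    shiftedWeight b c e 0 = ENNReal.ofReal (pathWeight b c e) := by
  simpa [shiftedWeight] using lintegral_brownianDensity_word hb hbc e

lemma brownianDensity_shift_le' {b c δ : ℝ} (hb : 0 < b) (hbc : b < c) (hδ : 0 ≤ δ) {n : ℕ}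
    (e : Fin n → Bool) {y t : Fin n → ℝ} (hy : ∀ k, |y k| ≤ δ) (ht : t ∈ orderedTimes n) :
    ENNReal.ofReal (brownianDensity t (fun k => raySlope b c (e k) * t k + y k))
      ≤ ENNReal.ofReal (Real.exp (2 * c * δ * n)) *
        ENNReal.ofReal (brownianDensity t (fun k => raySlope b c false * t k)) := by
  rw [← ENNReal.ofReal_mul (Real.exp_pos _).le]
  refine ENNReal.ofReal_le_ofReal ((brownianDensity_shift_le hb hbc hδ n e y t hy ht).trans ?_)
  refine mul_le_mul_of_nonneg_right ?_ (brownianDensity_nonneg _ _)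
  refine mul_le_of_le_one_right (Real.exp_pos _).le (Real.exp_le_one_iff.2 ?_)
  refine neg_nonpos.2 ?_
  rcases n with _ | n
  · simp
  · refine mul_nonneg ?_ (lastEntry_nonneg ht)
    rw [lastEntry_succ]
    have : b ≤ raySlope b c (e (Fin.last n)) := by
      cases e (Fin.last n) <;> simp [raySlope, hbc.le]
    nlinarith

lemma shiftedWeight_le {b c δ : ℝ} (hb : 0 < b) (hbc : b < c) (hδ : 0 ≤ δ) {n : ℕ}
    (e : Fin n → Bool) {y : Fin n → ℝ} (hy : ∀ k, |y k| ≤ δ) :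
    shiftedWeight b c e y ≤ ENNReal.ofReal (Real.exp (2 * c * δ * n)) *
      ENNReal.ofReal (pathWeight b c (fun _ : Fin n => false)) := by
  rw [← lintegral_brownianDensity_word hb hbc, ← lintegral_const_mul' _ _ ENNReal.ofReal_ne_top]
  exact setLIntegral_mono' (measurableSet_orderedTimes n)
    fun t ht => brownianDensity_shift_le' hb hbc hδ e hy ht

lemma continuous_brownianDensity {n : ℕ} (t : Fin n → ℝ) : Continuous (brownianDensity t) := by
  have hc : ∀ i : Fin (n + 1),
      Continuous (fun x : Fin n → ℝ => (Fin.cons 0 x : Fin (n + 1) → ℝ) i) := by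
    intro i
    refine Fin.cases ?_ (fun j => ?_) i
    · simpa using continuous_const
    · simpa using continuous_apply j
  have hg : ∀ v : ℝ≥0, Continuous (gaussianPDFReal 0 v) := fun v => by
    unfold gaussianPDFReal; fun_prop
  exact continuous_finsetProd _ fun i _ => (hg _).comp ((hc _).sub (hc _))

lemma tendsto_shiftedWeight {b c : ℝ} (hb : 0 < b) (hbc : b < c) {n : ℕ} (e : Fin n → Bool) :
    Tendsto (shiftedWeight b c e) (𝓝 0) (𝓝 (ENNReal.ofReal (pathWeight b c e))) := by
  rw [← shiftedWeight_zero hb hbc]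
  refine tendsto_lintegral_filter_of_dominated_convergence
    (fun t => ENNReal.ofReal (Real.exp (2 * c * 1 * n)) *
        ENNReal.ofReal (brownianDensity t (fun k => raySlope b c false * t k))) ?_ ?_ ?_ ?_
  · exact Eventually.of_forall fun y => (measurable_brownianDensity_ray _ _).ennreal_ofReal
  · have h1 : ∀ᶠ y : Fin n → ℝ in 𝓝 0, ∀ k, |y k| ≤ 1 := by
      rw [eventually_all]
      intro k
      have : Tendsto (fun y : Fin n → ℝ => |y k|) (𝓝 0) (𝓝 0) := by
        simpa using ((continuous_apply k).abs.tendsto (0 : Fin n → ℝ))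
      exact (this.eventually (gt_mem_nhds one_pos)).mono fun _ h => h.le
    filter_upwards [h1] with y hy
    exact (ae_restrict_iff' (measurableSet_orderedTimes n)).2
      (ae_of_all _ fun t ht => brownianDensity_shift_le' hb hbc zero_le_one e hy ht)
  · rw [lintegral_const_mul' _ _ ENNReal.ofReal_ne_top,
      lintegral_brownianDensity_word hb hbc (fun _ : Fin n => false)]
    exact ENNReal.mul_ne_top ENNReal.ofReal_ne_top ENNReal.ofReal_ne_top
  · refine ae_of_all _ fun t => ?_
    have hcont : Continuous (fun (y : Fin n → ℝ) k => raySlope b c (e k) * t k + y k) := by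
      fun_prop
    exact (ENNReal.continuous_ofReal.comp
      ((continuous_brownianDensity t).comp hcont)).tendsto (0 : Fin n → ℝ)

end Shift

/-! ### Finite-dimensional densities of Brownian motion -/

section Density

variable {Ω : Type*} [MeasurableSpace Ω] {P : Measure Ω} {W : ℝ≥0 → Ω → ℝ}

lemma ProbabilityTheory.IsPreBrownianReal.aemeasurable_tuple (hW : IsPreBrownianReal W P) {n : ℕ} (t : Fin n → ℝ) :
    AEMeasurable (fun ω (i : Fin n) => W (t i).toNNReal ω) P :=
  aemeasurable_pi_lambda _ fun _ => hW.aemeasurable _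

/-- The last increment is independent of the earlier values and Gaussian, so the joint law is built
up one coordinate at a time, matching `brownianDensity_snoc`. -/
lemma ProbabilityTheory.IsPreBrownianReal.lintegral_tuple [IsProbabilityMeasure P] (hW : IsPreBrownianReal W P)
    (n : ℕ) : ∀ (t : Fin n → ℝ), t ∈ orderedTimes n →
    ∀ (F : (Fin n → ℝ) → ENNReal), Measurable F →
      ∫⁻ ω, F (fun i => W (t i).toNNReal ω) ∂P
        = ∫⁻ x, F x * ENNReal.ofReal (brownianDensity t x) := by
  induction n with
  | zero =>
    intro t _ F hF
    have h1 : ∀ ω, F (fun i => W (t i).toNNReal ω) = F isEmptyElim := fun ω => by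
      congr 1; exact Subsingleton.elim _ _
    simp [h1, brownianDensity, volume_pi, Measure.pi_of_empty (x := (isEmptyElim : Fin 0 → ℝ))]
  | succ n ih =>
    intro t ht F hF
    obtain ⟨t, s, rfl⟩ : ∃ (t' : Fin n → ℝ) (s : ℝ), t = Fin.snoc t' s :=
      ⟨Fin.init t, t (Fin.last n), (Fin.snoc_init_self t).symm⟩
    rw [snoc_mem_orderedTimes_iff] at ht
    obtain ⟨ht, hs⟩ := ht
    have ht0 := lastEntry_nonneg ht
    set t₀ : ℝ≥0 := (lastEntry t).toNNReal with ht₀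
    set u : ℝ≥0 := (s - lastEntry t).toNNReal with hu
    have hu0 : u ≠ 0 := by rw [hu]; simpa using hs
    have hts : t₀ + u = s.toNNReal := by
      rw [ht₀, hu, ← Real.toNNReal_add ht0 (sub_pos.2 hs).le]; congr 1; ring
    set X : Ω → Fin n → ℝ := fun ω i => W (t i).toNNReal ω with hX
    set D : Ω → ℝ := fun ω => W (t₀ + u) ω - W t₀ ω with hD
    -- For the empty tuple this says that `W` starts at `0`, which holds only almost surely.
    have hlast : ∀ᵐ ω ∂P, W t₀ ω = lastEntry (X ω) := by
      rcases n with _ | n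
      · filter_upwards [hW.eval_zero_ae_eq_zero] with ω hω
        simpa [ht₀] using hω
      · refine ae_of_all _ fun ω => ?_
        rw [ht₀, lastEntry_succ, lastEntry_succ]
    have hle : ∀ i, (t i).toNNReal ≤ t₀ := by
      intro i
      rcases n with _ | n
      · exact i.elim0
      · rw [ht₀, lastEntry_succ]
        exact Real.toNNReal_le_toNNReal (ht.2.monotone (Fin.le_last i))
    have hXm : AEMeasurable X P := hW.aemeasurable_tuple t
    have hDm : AEMeasurable D P := (hW.aemeasurable _).sub (hW.aemeasurable _)
    have hind : IndepFun X D P :=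
      ((hW.indepFun_shift t₀).comp (measurable_pi_apply u : Measurable fun f : ℝ≥0 → ℝ => f u)
        (measurable_pi_lambda _ fun i => measurable_pi_apply _ : Measurable
          fun (g : Set.Iic t₀ → ℝ) (i : Fin n) => g ⟨(t i).toNNReal, hle i⟩)).symm
    have hlaw : P.map D = gaussianReal 0 u := ((hW.shift t₀).hasLaw_eval u).map_eq
    have hprod := (indepFun_iff_map_prod_eq_prod_map_map hXm hDm).1 hind
    set K : (Fin n → ℝ) × ℝ → ENNReal := fun p =>
      F (Fin.snoc p.1 (lastEntry p.1 + p.2)) with hK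
    have hKm : Measurable K :=
      hF.comp (measurable_snoc.comp (measurable_fst.prodMk
        ((measurable_lastEntry.comp measurable_fst).add measurable_snd)))
    set H : (Fin n → ℝ) → ENNReal := fun x => ∫⁻ d, K (x, d) ∂(gaussianReal 0 u) with hH
    have hHm : Measurable H := hKm.lintegral_prod_right'
    have hH' : ∀ x, H x = ∫⁻ z, F (Fin.snoc x z) *
        ENNReal.ofReal (gaussianPDFReal 0 u (z - lastEntry x)) := by
      intro x
      have hm : Measurable (fun d => K (x, d)) := hKm.comp measurable_prodMk_left
      rw [hH]
      simp only
      rw [gaussianReal_of_var_ne_zero _ hu0, lintegral_withDensity_eq_lintegral_mul _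
        (measurable_gaussianPDF _ _) hm]
      refine Eq.trans ?_ (lintegral_add_left_eq_self _ (lastEntry x))
      refine lintegral_congr fun d => ?_
      simp only [hK, Pi.mul_apply, gaussianPDF, add_sub_cancel_left]
      rw [mul_comm]
    calc ∫⁻ ω, F (fun i => W ((Fin.snoc t s : Fin (n + 1) → ℝ) i).toNNReal ω) ∂P
        = ∫⁻ ω, K (X ω, D ω) ∂P := by
          refine lintegral_congr_ae ?_
          filter_upwards [hlast] with ω hω
          simp only [hK]
          congr 1
          funext i
          refine Fin.lastCases ?_ (fun j => ?_) i
          · simp only [Fin.snoc_last, ← hω, hD, hts]; ring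
          · simp [hX]
      _ = ∫⁻ p, K p ∂(P.map (fun ω => (X ω, D ω))) :=
          (lintegral_map' hKm.aemeasurable (hXm.prodMk hDm)).symm
      _ = ∫⁻ x, H x ∂(P.map X) := by
          rw [hprod, hlaw, lintegral_prod _ hKm.aemeasurable]
      _ = ∫⁻ ω, H (X ω) ∂P := lintegral_map' hHm.aemeasurable hXm
      _ = ∫⁻ x, H x * ENNReal.ofReal (brownianDensity t x) := ih t ht H hHm
      _ = _ := by
          rw [lintegral_fin_succ]
          · refine lintegral_congr fun x => ?_
            rw [hH', ← lintegral_mul_const' _ _ ENNReal.ofReal_ne_top]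
            refine lintegral_congr fun z => ?_
            rw [brownianDensity_snoc, ENNReal.ofReal_mul (brownianDensity_nonneg _ _), hu]
            ring
          · exact hF.mul (continuous_brownianDensity _).measurable.ennreal_ofReal

lemma ProbabilityTheory.IsPreBrownianReal.measure_box [IsProbabilityMeasure P] (hW : IsPreBrownianReal W P)
    {n : ℕ} {t : Fin n → ℝ} (ht : t ∈ orderedTimes n) (x ε : Fin n → ℝ) :
    P {ω | ∀ k, |W (t k).toNNReal ω - x k| ≤ ε k / 2}
      = ∫⁻ y in {y : Fin n → ℝ | ∀ k, |y k| ≤ ε k / 2},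
        ENNReal.ofReal (brownianDensity t (fun k => x k + y k)) := by
  have hB : MeasurableSet {y : Fin n → ℝ | ∀ k, |y k| ≤ ε k / 2} := by
    rw [Set.ofPred_forall]
    exact MeasurableSet.iInter fun k => measurableSet_le (by fun_prop) (by fun_prop)
  have hB' : MeasurableSet {z : Fin n → ℝ | ∀ k, |z k - x k| ≤ ε k / 2} := by
    rw [Set.ofPred_forall]
    exact MeasurableSet.iInter fun k => measurableSet_le (by fun_prop) (by fun_prop)
  have h := hW.lintegral_tuple n t ht
    ({z : Fin n → ℝ | ∀ k, |z k - x k| ≤ ε k / 2}.indicator 1) (measurable_one.indicator hB')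
  have h2 : ∫⁻ ω, ({z : Fin n → ℝ | ∀ k, |z k - x k| ≤ ε k / 2}.indicator 1
      (fun i => W (t i).toNNReal ω) : ENNReal) ∂P
      = P {ω | ∀ k, |W (t k).toNNReal ω - x k| ≤ ε k / 2} := by
    refine Eq.trans (lintegral_congr fun ω => ?_)
      (lintegral_indicator_one₀ ((hW.aemeasurable_tuple t).nullMeasurableSet_preimage hB'))
    rfl
  rw [← h2, h, ← lintegral_indicator hB, ← lintegral_add_left_eq_self (μ := volume) _ x]
  refine lintegral_congr fun y => ?_
  by_cases hy : ∀ k, |y k| ≤ ε k / 2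
  · rw [Set.indicator_of_mem (by simpa using hy), Set.indicator_of_mem (by simpa using hy)]
    simp [Pi.add_def]
  · rw [Set.indicator_of_notMem (by simpa using hy), Set.indicator_of_notMem (by simpa using hy)]
    simp

end Density

/-! ### Reordering times -/

section Reorder

lemma ae_injective_ne_zero (n : ℕ) :
    ∀ᵐ s : Fin n → ℝ, (∀ i, s i ≠ 0) ∧ Function.Injective s := by
  have h1 : ∀ i : Fin n, ∀ᵐ s : Fin n → ℝ, s i ≠ 0 := by
    intro i
    have := Measure.addHaar_submodule (volume : Measure (Fin n → ℝ))
      (LinearMap.ker (LinearMap.proj i : (Fin n → ℝ) →ₗ[ℝ] ℝ)) (fun h => by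
        have h2 : (fun _ => 1 : Fin n → ℝ) ∈ LinearMap.ker (LinearMap.proj i :
          (Fin n → ℝ) →ₗ[ℝ] ℝ) := h ▸ Submodule.mem_top
        simp at h2)
    rw [ae_iff]
    convert this using 2
    ext s; simp
  have h2 : ∀ i j : Fin n, ∀ᵐ s : Fin n → ℝ, s i = s j → i = j := by
    intro i j
    by_cases hij : i = j
    · simp [hij]
    have := Measure.addHaar_submodule (volume : Measure (Fin n → ℝ))
      (LinearMap.ker ((LinearMap.proj i : (Fin n → ℝ) →ₗ[ℝ] ℝ) - LinearMap.proj j)) (fun h => by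
        have h2 : (Pi.single i 1 : Fin n → ℝ) ∈ LinearMap.ker
          ((LinearMap.proj i : (Fin n → ℝ) →ₗ[ℝ] ℝ) - LinearMap.proj j) := h ▸ Submodule.mem_top
        simp [Pi.single_eq_of_ne (Ne.symm hij)] at h2)
    rw [ae_iff]
    convert this using 2
    ext s; simp [hij, sub_eq_zero]
  filter_upwards [ae_all_iff.2 h1, ae_all_iff.2 fun i => ae_all_iff.2 (h2 i)] with s hs hs'
  exact ⟨hs, fun i j h => hs' i j h⟩

lemma measurable_reindex {n : ℕ} (σ : Fin n → Fin n) :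
    Measurable (fun t : Fin n → ℝ => t ∘ σ) :=
  measurable_pi_lambda _ fun _ => measurable_pi_apply _

lemma lintegral_comp_perm {n : ℕ} (σ : Equiv.Perm (Fin n)) (f : (Fin n → ℝ) → ENNReal) :
    ∫⁻ t, f (t ∘ σ) = ∫⁻ t, f t := by
  have h := volume_measurePreserving_piCongrLeft (fun _ : Fin n => ℝ) σ⁻¹
  refine (lintegral_congr fun t => ?_).trans
    (h.lintegral_comp_emb (MeasurableEquiv.measurableEmbedding _) f)
  congr 1
  funext i
  have := Equiv.piCongrLeft_apply_apply (P := fun _ : Fin n => ℝ) (e := σ⁻¹) t (σ i)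
  rw [MeasurableEquiv.coe_piCongrLeft]
  simpa using this.symm

lemma eq_of_comp_inv_mem_orderedTimes {n : ℕ} {s : Fin n → ℝ} {σ τ : Equiv.Perm (Fin n)}
    (hσ : s ∘ ⇑σ⁻¹ ∈ orderedTimes n) (hτ : s ∘ ⇑τ⁻¹ ∈ orderedTimes n) : σ = τ := by
  have h : s ∘ ⇑σ⁻¹ = s ∘ ⇑τ⁻¹ := by
    refine (StrictMono.range_inj hσ.2 hτ.2).1 ?_
    rw [EquivLike.range_comp, EquivLike.range_comp]
  have hs : Function.Injective s := fun i j hij => by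
    have h1 := hσ.2.injective (a₁ := σ i) (a₂ := σ j) (by simpa using hij)
    exact σ.injective h1
  refine inv_injective (Equiv.ext fun i => hs ?_)
  exact congrFun h i

lemma exists_comp_inv_mem_orderedTimes {n : ℕ} {s : Fin n → ℝ} (h0 : ∀ i, 0 < s i)
    (hs : Function.Injective s) : ∃ σ : Equiv.Perm (Fin n), s ∘ ⇑σ⁻¹ ∈ orderedTimes n := by
  refine ⟨(Tuple.sort s)⁻¹, fun i => h0 _, ?_⟩
  rw [inv_inv]
  exact (Tuple.monotone_sort s).strictMono_of_injective (hs.comp (Tuple.sort s).injective)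

/-- Off finitely many hyperplanes the coordinates are nonzero and distinct; if none is negative,
exactly one permutation sorts them. -/
lemma lintegral_eq_sum_perm {n : ℕ} {Q : (Fin n → ℝ) → ENNReal} (hQ : Measurable Q)
    (h0 : ∀ t, (∃ k, t k < 0) → Q t = 0) :
    ∫⁻ t, Q t = ∑ σ : Equiv.Perm (Fin n), ∫⁻ t in orderedTimes n, Q (t ∘ σ) := by
  have hmeas : ∀ σ : Equiv.Perm (Fin n),
      MeasurableSet {s : Fin n → ℝ | s ∘ ⇑σ⁻¹ ∈ orderedTimes n} := fun σ =>
    (measurable_reindex _) (measurableSet_orderedTimes n)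
  have h1 : ∀ σ : Equiv.Perm (Fin n), ∫⁻ t in orderedTimes n, Q (t ∘ σ)
      = ∫⁻ s, {s : Fin n → ℝ | s ∘ ⇑σ⁻¹ ∈ orderedTimes n}.indicator Q s := by
    intro σ
    rw [← lintegral_indicator (measurableSet_orderedTimes n), ← lintegral_comp_perm σ⁻¹]
    refine lintegral_congr fun s => ?_
    have hs : (s ∘ ⇑σ⁻¹) ∘ ⇑σ = s := by funext i; simp
    by_cases h : s ∘ ⇑σ⁻¹ ∈ orderedTimes n
    · rw [Set.indicator_of_mem h, Set.indicator_of_mem (by exact h), hs]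
    · rw [Set.indicator_of_notMem h, Set.indicator_of_notMem (by exact h)]
  rw [Finset.sum_congr rfl fun σ _ => h1 σ,
    ← lintegral_finsetSum _ (fun σ _ => hQ.indicator (hmeas σ))]
  refine lintegral_congr_ae ?_
  filter_upwards [ae_injective_ne_zero n] with s hs
  by_cases hneg : ∃ k, s k < 0
  · rw [h0 s hneg, Finset.sum_eq_zero]
    intro σ _
    simp [h0 s hneg]
  · push Not at hneg
    obtain ⟨σ, hσ⟩ := exists_comp_inv_mem_orderedTimes
      (fun i => lt_of_le_of_ne (hneg i) (hs.1 i).symm) hs.2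
    rw [Finset.sum_eq_single σ]
    · rw [Set.indicator_of_mem (by exact hσ)]
    · intro τ _ hτ
      refine Set.indicator_of_notMem ?_ Q
      exact fun h => hτ (eq_of_comp_inv_mem_orderedTimes h hσ)
    · simp

end Reorder

/-! ### Moments of the occupation times -/

section Occupation

variable {Ω : Type*} [MeasurableSpace Ω] {P : Measure Ω} {W : ℝ≥0 → Ω → ℝ}

/-- Tonelli needs joint measurability. On a measurable set of full measure the paths are continuous
and agree with measurable versions at a dense sequence of times; the modification is `W` there and
`0` elsewhere. -/
lemma ProbabilityTheory.IsBrownianReal.exists_measurable_uncurry (hW : IsBrownianReal W P) :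
    ∃ Z : ℝ≥0 → Ω → ℝ, Measurable (Function.uncurry Z) ∧ ∀ᵐ ω ∂P, ∀ t, W t ω = Z t ω := by
  set d := TopologicalSpace.denseSeq ℝ≥0 with hd
  have hdd : DenseRange d := TopologicalSpace.denseRange_denseSeq ℝ≥0
  have hA : ∀ᵐ ω ∂P, Continuous (W · ω) ∧ ∀ n, W (d n) ω = (hW.aemeasurable (d n)).mk _ ω :=
    hW.cont.and (ae_all_iff.2 fun n => (hW.aemeasurable (d n)).ae_eq_mk)
  obtain ⟨A, hAae, hAm, hA⟩ := hA.exists_measurable_mem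
  refine ⟨fun t => A.indicator (W t), measurable_uncurry_of_continuous_of_measurable ?_ ?_, ?_⟩
  · intro ω
    by_cases hω : ω ∈ A
    · simpa [Set.indicator_of_mem hω] using (hA ω hω).1
    · simpa [Set.indicator_of_notMem hω] using continuous_const
  · intro t
    obtain ⟨x, hx, hxt⟩ := mem_closure_iff_seq_limit.1 (hdd t)
    choose k hk using hx
    refine measurable_of_tendsto_metrizable (f := fun m => A.indicator
      ((hW.aemeasurable (d (k m))).mk _))
      (fun m => (hW.aemeasurable (d (k m))).measurable_mk.indicator hAm) ?_
    rw [tendsto_pi_nhds]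
    intro ω
    by_cases hω : ω ∈ A
    · simp only [Set.indicator_of_mem hω]
      refine (((hA ω hω).1.tendsto t).comp hxt).congr fun m => ?_
      simp only [Function.comp, ← hk m]
      exact (hA ω hω).2 (k m)
    · simp only [Set.indicator_of_notMem hω]
      exact tendsto_const_nhds
  · filter_upwards [hAae] with ω hω t
    simp [Set.indicator_of_mem hω]

/-- The time spent by the path within distance `ε / 2` of the ray of slope `v`. -/
noncomputable def occupation (W : ℝ≥0 → Ω → ℝ) (v ε : ℝ) (ω : Ω) : ENNReal :=
  volume {t : ℝ | 0 ≤ t ∧ |W t.toNNReal ω - v * t| ≤ ε / 2}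

lemma measurableSet_occupation {Z : ℝ≥0 → Ω → ℝ} (hZ : Measurable (Function.uncurry Z))
    (v ε : ℝ) :
    MeasurableSet {p : Ω × ℝ | 0 ≤ p.2 ∧ |Z p.2.toNNReal p.1 - v * p.2| ≤ ε / 2} := by
  have h1 : Measurable (fun p : Ω × ℝ => Z p.2.toNNReal p.1) :=
    hZ.comp (measurable_snd.real_toNNReal.prodMk measurable_fst)
  have h2 : Measurable (fun p : Ω × ℝ => |Z p.2.toNNReal p.1 - v * p.2|) :=
    (h1.sub (measurable_snd.const_mul v)).abs
  exact (measurableSet_le measurable_const measurable_snd).inter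
    (measurableSet_le h2 measurable_const)

lemma aemeasurable_occupation (hW : IsBrownianReal W P) (v ε : ℝ) :
    AEMeasurable (occupation W v ε) P := by
  obtain ⟨Z, hZ, hWZ⟩ := hW.exists_measurable_uncurry
  refine ⟨occupation Z v ε, measurable_measure_prodMk_left (measurableSet_occupation hZ v ε), ?_⟩
  filter_upwards [hWZ] with ω hω
  simp [occupation, hω]

lemma measurableSet_box {n : ℕ} (ε : Fin n → ℝ) :
    MeasurableSet {y : Fin n → ℝ | ∀ k, |y k| ≤ ε k / 2} := by
  rw [Set.ofPred_forall]
  exact MeasurableSet.iInter fun k => measurableSet_le (by fun_prop) (by fun_prop)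

/-- The product of occupation times is the volume of a set of time vectors, so Tonelli leads to box
probabilities at fixed times. -/
lemma lintegral_prod_occupation [IsProbabilityMeasure P] (hW : IsBrownianReal W P) (b c : ℝ)
    {n : ℕ} (e : Fin n → Bool) (ε : Fin n → ℝ) :
    ∫⁻ ω, ∏ k, occupation W (raySlope b c (e k)) (ε k) ω ∂P
      = ∑ σ : Equiv.Perm (Fin n), ∫⁻ y in {y : Fin n → ℝ | ∀ k, |y k| ≤ ε (σ k) / 2},
          shiftedWeight b c (e ∘ σ) y := by
  obtain ⟨Z, hZ, hWZ⟩ := hW.exists_measurable_uncurry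
  set v : Fin n → ℝ := fun k => raySlope b c (e k) with hv
  set A : Set (Ω × (Fin n → ℝ)) :=
    {p | ∀ k, 0 ≤ p.2 k ∧ |Z (p.2 k).toNNReal p.1 - v k * p.2 k| ≤ ε k / 2} with hA
  have hAm : MeasurableSet A := by
    rw [hA, Set.ofPred_forall]
    refine MeasurableSet.iInter fun k => ?_
    exact (measurable_fst.prodMk ((measurable_pi_apply k).comp measurable_snd) :
      Measurable fun p : Ω × (Fin n → ℝ) => (p.1, p.2 k)) (measurableSet_occupation hZ (v k) (ε k))
  have h1 : ∫⁻ ω, ∏ k, occupation W (v k) (ε k) ω ∂P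
      = ∫⁻ ω, volume (Prod.mk ω ⁻¹' A) ∂P := by
    refine lintegral_congr_ae ?_
    filter_upwards [hWZ] with ω hω
    simp only [occupation, hω]
    rw [← volume_pi_pi]
    congr 1
    ext t
    simp [hA]
  have h2 : ∫⁻ ω, volume (Prod.mk ω ⁻¹' A) ∂P
      = ∫⁻ t : Fin n → ℝ, P ((fun ω => (ω, t)) ⁻¹' A) := by
    rw [← Measure.prod_apply hAm, Measure.prod_apply_symm hAm]
  -- Summing over inverses makes the `k`-th smallest time carry the letter and the width with index
  -- `σ k`.
  rw [h1, h2, lintegral_eq_sum_perm (measurable_measure_prodMk_right hAm), ← Equiv.sum_comp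
    (Equiv.inv (Equiv.Perm (Fin n)))]
  · refine Finset.sum_congr rfl fun σ _ => ?_
    have h3 : ∀ t ∈ orderedTimes n, P ((fun ω => (ω, t ∘ ⇑σ⁻¹)) ⁻¹' A)
        = ∫⁻ y in {y : Fin n → ℝ | ∀ k, |y k| ≤ ε (σ k) / 2},
          ENNReal.ofReal (brownianDensity t
            (fun k => raySlope b c ((e ∘ σ) k) * t k + y k)) := by
      intro t ht
      rw [← hW.measure_box ht (fun k => raySlope b c ((e ∘ σ) k) * t k) (fun k => ε (σ k))]
      refine measure_congr ?_
      filter_upwards [hWZ] with ω hω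
      refine propext (Iff.trans (b := ∀ k, 0 ≤ (t ∘ ⇑σ⁻¹) k ∧
        |Z ((t ∘ ⇑σ⁻¹) k).toNNReal ω - v k * (t ∘ ⇑σ⁻¹) k| ≤ ε k / 2) Iff.rfl ?_)
      refine Iff.trans (σ.forall_congr_right).symm ?_
      refine forall_congr' fun k => ?_
      simp [hω, hv, (ht.1 k).le]
    simp only [Equiv.inv_apply]
    rw [setLIntegral_congr_fun (measurableSet_orderedTimes n) h3]
    unfold shiftedWeight
    rw [lintegral_lintegral_swap]
    have hg : Measurable (fun (p : (Fin n → ℝ) × (Fin n → ℝ)) k =>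
        raySlope b c ((e ∘ σ) k) * p.1 k + p.2 k) := by fun_prop
    have hD : Measurable (fun q : ((Fin n → ℝ) × (Fin n → ℝ)) × (Fin n → ℝ) =>
        brownianDensity q.1.1 q.2) :=
      measurable_brownianDensity.comp ((measurable_fst.comp measurable_fst).prodMk measurable_snd)
    exact (Measurable.comp_graph (D := fun (p : (Fin n → ℝ) × (Fin n → ℝ)) x =>
      brownianDensity p.1 x) hD hg).ennreal_ofReal.aemeasurable
  · rintro t ⟨k, hk⟩
    have : (fun ω => (ω, t)) ⁻¹' A = ∅ := by
      ext ω
      simp only [hA, Set.mem_preimage, Set.mem_ofPred_eq, Set.mem_empty_iff_false, iff_false]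
      intro h
      exact absurd (h k).1 (not_le.2 hk)
    rw [this, measure_empty]

end Occupation

/-! ### Limits of the moments -/

section Moments

lemma volume_box {n : ℕ} (ε : Fin n → ℝ) :
    volume {y : Fin n → ℝ | ∀ k, |y k| ≤ ε k / 2} = ∏ k, ENNReal.ofReal (ε k) := by
  have : {y : Fin n → ℝ | ∀ k, |y k| ≤ ε k / 2}
      = Set.univ.pi fun k => Set.Icc (-(ε k / 2)) (ε k / 2) := by
    ext y; simp only [abs_le, Set.mem_pi, Set.mem_univ, true_imp_iff, Set.mem_Icc, Set.mem_ofPred_eq]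
  rw [this, volume_pi_pi]
  refine Finset.prod_congr rfl fun k _ => ?_
  rw [Real.volume_Icc]
  congr 1
  ring

lemma volume_box_ne_zero {n : ℕ} {ε : Fin n → ℝ} (hε : ∀ k, 0 < ε k) :
    ∏ k, ENNReal.ofReal (ε k) ≠ 0 :=
  Finset.prod_ne_zero_iff.2 fun k _ => (ENNReal.ofReal_pos.2 (hε k)).ne'

lemma volume_box_ne_top {n : ℕ} (ε : Fin n → ℝ) : ∏ k, ENNReal.ofReal (ε k) ≠ ⊤ :=
  ENNReal.prod_ne_top fun _ _ => ENNReal.ofReal_ne_top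

lemma average_box_le {n : ℕ} {ε : Fin n → ℝ} {G : (Fin n → ℝ) → ENNReal} {C : ENNReal}
    (hG : ∀ y, (∀ k, |y k| ≤ ε k / 2) → G y ≤ C) :
    (∏ k, ENNReal.ofReal (ε k))⁻¹ * ∫⁻ y in {y : Fin n → ℝ | ∀ k, |y k| ≤ ε k / 2}, G y ≤ C := by
  calc _ ≤ (∏ k, ENNReal.ofReal (ε k))⁻¹ *
        ∫⁻ y in {y : Fin n → ℝ | ∀ k, |y k| ≤ ε k / 2}, C := by
          refine mul_le_mul_right ?_ _
          exact setLIntegral_mono' (measurableSet_box ε) fun y hy => hG y hy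
    _ = (∏ k, ENNReal.ofReal (ε k))⁻¹ * (∏ k, ENNReal.ofReal (ε k)) * C := by
          rw [setLIntegral_const, volume_box]; ring
    _ ≤ 1 * C := by gcongr; exact ENNReal.inv_mul_le_one _
    _ = C := one_mul C

lemma le_average_box {n : ℕ} {ε : Fin n → ℝ} (hε : ∀ k, 0 < ε k) {G : (Fin n → ℝ) → ENNReal}
    {C : ENNReal} (hG : ∀ y, (∀ k, |y k| ≤ ε k / 2) → C ≤ G y) :
    C ≤ (∏ k, ENNReal.ofReal (ε k))⁻¹ *
      ∫⁻ y in {y : Fin n → ℝ | ∀ k, |y k| ≤ ε k / 2}, G y := by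
  calc C = (∏ k, ENNReal.ofReal (ε k))⁻¹ * (∏ k, ENNReal.ofReal (ε k)) * C := by
          rw [ENNReal.inv_mul_cancel (volume_box_ne_zero hε) (volume_box_ne_top ε), one_mul]
    _ = (∏ k, ENNReal.ofReal (ε k))⁻¹ *
        ∫⁻ y in {y : Fin n → ℝ | ∀ k, |y k| ≤ ε k / 2}, C := by
          rw [setLIntegral_const, volume_box]; ring
    _ ≤ _ := by
          refine mul_le_mul_right ?_ _
          exact setLIntegral_mono' (measurableSet_box ε) fun y hy => hG y hy

lemma tendsto_average_box {n : ℕ} {G : (Fin n → ℝ) → ENNReal} {g : ENNReal} (hg : g ≠ ⊤)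
    (hG : Tendsto G (𝓝 0) (𝓝 g)) :
    Tendsto (fun ε : Fin n → ℝ => (∏ k, ENNReal.ofReal (ε k))⁻¹ *
      ∫⁻ y in {y : Fin n → ℝ | ∀ k, |y k| ≤ ε k / 2}, G y)
      (𝓝[{ε | ∀ k, 0 < ε k}] 0) (𝓝 g) := by
  rw [ENNReal.tendsto_nhds hg] at hG ⊢
  intro η hη
  obtain ⟨δ, hδ, hGδ⟩ := Metric.eventually_nhds_iff.1 (hG η hη)
  have hball : ∀ᶠ ε : Fin n → ℝ in 𝓝[{ε | ∀ k, 0 < ε k}] 0, dist ε 0 < δ :=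
    nhdsWithin_le_nhds (Metric.ball_mem_nhds _ hδ)
  filter_upwards [hball, eventually_mem_nhdsWithin] with ε hεδ hε
  have hy : ∀ y : Fin n → ℝ, (∀ k, |y k| ≤ ε k / 2) → dist y 0 < δ := by
    intro y hy
    rw [dist_pi_lt_iff hδ] at hεδ ⊢
    intro k
    have h1 := hεδ k
    have h2 := hε k
    simp only [Pi.zero_apply, dist_zero_right, Real.norm_eq_abs] at h1 ⊢
    rw [abs_of_pos h2] at h1
    linarith [hy k]
  exact ⟨le_average_box hε fun y h => (hGδ (hy y h)).1, average_box_le fun y h => (hGδ (hy y h)).2⟩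

variable {Ω : Type*} [MeasurableSpace Ω] {P : Measure Ω}
  {W : ℝ≥0 → Ω → ℝ} {b c : ℝ}

lemma lintegral_prod_scaled_occupation [IsProbabilityMeasure P] (hW : IsBrownianReal W P) {n : ℕ} (e : Fin n → Bool)
    (ε : Fin n → ℝ) :
    ∫⁻ ω, ∏ k, ((ENNReal.ofReal (ε k))⁻¹ * occupation W (raySlope b c (e k)) (ε k) ω) ∂P
      = ∑ σ : Equiv.Perm (Fin n), (∏ k, ENNReal.ofReal ((ε ∘ σ) k))⁻¹ *
          ∫⁻ y in {y : Fin n → ℝ | ∀ k, |y k| ≤ (ε ∘ σ) k / 2}, shiftedWeight b c (e ∘ σ) y := by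
  have hinv : ∏ k, (ENNReal.ofReal (ε k))⁻¹ = (∏ k, ENNReal.ofReal (ε k))⁻¹ :=
    (ENNReal.prod_inv_distrib fun i _ j _ _ => Or.inr ENNReal.ofReal_ne_top).symm
  simp_rw [Finset.prod_mul_distrib]
  rw [lintegral_const_mul'' _ (Finset.aemeasurable_fun_prod _ fun k _ =>
    aemeasurable_occupation hW _ _), lintegral_prod_occupation hW, Finset.mul_sum]
  refine Finset.sum_congr rfl fun σ _ => ?_
  rw [hinv]
  congr 2
  exact (Equiv.prod_comp σ (fun k => ENNReal.ofReal (ε k))).symm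

lemma lintegral_prod_scaled_occupation_lt_top [IsProbabilityMeasure P] (hW : IsBrownianReal W P) (hb : 0 < b)
    (hbc : b < c) {n : ℕ} (e : Fin n → Bool) {ε : Fin n → ℝ} (hε : ∀ k, 0 < ε k) :
    ∫⁻ ω, ∏ k, ((ENNReal.ofReal (ε k))⁻¹ * occupation W (raySlope b c (e k)) (ε k) ω) ∂P < ⊤ := by
  rw [lintegral_prod_scaled_occupation hW, ENNReal.sum_lt_top]
  intro σ _
  -- The sum of the widths serves as a common bound for the shifts, without a maximum over a
  -- possibly empty index set.
  have hδ : 0 ≤ ∑ k, ε k := Finset.sum_nonneg fun k _ => (hε k).le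
  refine (average_box_le (C := ENNReal.ofReal (Real.exp (2 * c * (∑ k, ε k) * n)) *
      ENNReal.ofReal (pathWeight b c (fun _ : Fin n => false))) fun y hy =>
      shiftedWeight_le hb hbc hδ _ fun k => (hy k).trans ?_).trans_lt
    (ENNReal.mul_lt_top ENNReal.ofReal_lt_top ENNReal.ofReal_lt_top)
  have := Finset.single_le_sum (f := ε) (fun k _ => (hε k).le) (Finset.mem_univ (σ k))
  have h2 := hε (σ k)
  simp only [Function.comp]
  linarith

lemma tendsto_lintegral_prod_scaled_occupation [IsProbabilityMeasure P] (hW : IsBrownianReal W P) (hb : 0 < b)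
    (hbc : b < c) {n : ℕ} (e : Fin n → Bool) :
    Tendsto (fun ε : Fin n → ℝ => ∫⁻ ω, ∏ k, ((ENNReal.ofReal (ε k))⁻¹ *
        occupation W (raySlope b c (e k)) (ε k) ω) ∂P)
      (𝓝[{ε | ∀ k, 0 < ε k}] 0)
      (𝓝 (ENNReal.ofReal (∑ σ : Equiv.Perm (Fin n), pathWeight b c (e ∘ σ)))) := by
  simp_rw [lintegral_prod_scaled_occupation hW]
  rw [ENNReal.ofReal_sum_of_nonneg fun σ _ => (pathWeight_pos hb hbc _).le]
  refine tendsto_finsetSum _ fun σ _ => ?_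
  have hσ : Tendsto (fun ε : Fin n → ℝ => ε ∘ σ) (𝓝[{ε | ∀ k, 0 < ε k}] 0)
      (𝓝[{ε | ∀ k, 0 < ε k}] 0) := by
    refine tendsto_nhdsWithin_iff.2 ⟨?_, eventually_mem_nhdsWithin.mono fun ε hε k => hε (σ k)⟩
    have : Continuous (fun ε : Fin n → ℝ => ε ∘ σ) := by
      refine continuous_pi fun k => continuous_apply (σ k)
    exact (this.tendsto 0).mono_left nhdsWithin_le_nhds
  exact (tendsto_average_box ENNReal.ofReal_ne_top (tendsto_shiftedWeight hb hbc (e ∘ σ))).comp hσ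

lemma relTime_eq {Ω : Type*} (W : ℝ≥0 → Ω → ℝ) (v ε : ℝ) (ω : Ω) :
    relTime W v ε ω = ε⁻¹ * (occupation W v ε ω).toReal := rfl

lemma relTime_nonneg {Ω : Type*} (W : ℝ≥0 → Ω → ℝ) (v : ℝ) {ε : ℝ} (hε : 0 < ε) (ω : Ω) :
    0 ≤ relTime W v ε ω :=
  mul_nonneg (inv_nonneg.2 hε.le) ENNReal.toReal_nonneg

lemma aemeasurable_relTime (hW : IsBrownianReal W P) (v ε : ℝ) :
    AEMeasurable (relTime W v ε) P :=
  (aemeasurable_occupation hW v ε).ennreal_toReal.const_mul _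

/-- `relTime` uses a real-valued measure, which sends infinite volume to `0`; the finite first
moment excludes this almost surely. -/
lemma occupation_lt_top [IsProbabilityMeasure P] (hW : IsBrownianReal W P) (hb : 0 < b) (hbc : b < c) (x : Bool) {ε : ℝ}
    (hε : 0 < ε) : ∀ᵐ ω ∂P, occupation W (raySlope b c x) ε ω < ⊤ := by
  have h := lintegral_prod_scaled_occupation_lt_top hW hb hbc (fun _ : Fin 1 => x)
    (ε := fun _ => ε) (fun _ => hε)
  simp only [Finset.univ_unique, Finset.prod_const, Finset.card_singleton, pow_one] at h
  filter_upwards [ae_lt_top' ((aemeasurable_occupation hW _ _).const_mul _) h.ne] with ω hω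
  by_contra htop
  rw [not_lt, top_le_iff] at htop
  rw [htop, ENNReal.mul_top (ENNReal.inv_ne_zero.2 ENNReal.ofReal_ne_top)] at hω
  exact absurd hω (lt_irrefl _)

lemma ofReal_relTime [IsProbabilityMeasure P] (hW : IsBrownianReal W P) (hb : 0 < b) (hbc : b < c) (x : Bool) {ε : ℝ}
    (hε : 0 < ε) : ∀ᵐ ω ∂P, ENNReal.ofReal (relTime W (raySlope b c x) ε ω)
      = (ENNReal.ofReal ε)⁻¹ * occupation W (raySlope b c x) ε ω := by
  filter_upwards [occupation_lt_top hW hb hbc x hε] with ω hω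
  rw [relTime_eq, ENNReal.ofReal_mul (inv_nonneg.2 hε.le), ENNReal.ofReal_toReal hω.ne,
    ENNReal.ofReal_inv_of_pos hε]

lemma lintegral_prod_relTime [IsProbabilityMeasure P] (hW : IsBrownianReal W P) (hb : 0 < b) (hbc : b < c) {n : ℕ}
    (e : Fin n → Bool) {ε : Fin n → ℝ} (hε : ∀ k, 0 < ε k) :
    ∫⁻ ω, ENNReal.ofReal (∏ k, relTime W (raySlope b c (e k)) (ε k) ω) ∂P
      = ∫⁻ ω, ∏ k, ((ENNReal.ofReal (ε k))⁻¹ *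
        occupation W (raySlope b c (e k)) (ε k) ω) ∂P := by
  refine lintegral_congr_ae ?_
  filter_upwards [ae_all_iff.2 fun k => ofReal_relTime hW hb hbc (e k) (hε k)] with ω hω
  rw [ENNReal.ofReal_prod_of_nonneg fun k _ => relTime_nonneg W _ (hε k) ω]
  exact Finset.prod_congr rfl fun k _ => hω k

lemma aemeasurable_prod_relTime (hW : IsBrownianReal W P) {n : ℕ} (e : Fin n → Bool)
    (ε : Fin n → ℝ) : AEMeasurable (fun ω => ∏ k, relTime W (raySlope b c (e k)) (ε k) ω) P :=
  Finset.aemeasurable_fun_prod _ fun _ _ => aemeasurable_relTime hW _ _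

lemma integrable_prod_relTime [IsProbabilityMeasure P] (hW : IsBrownianReal W P) (hb : 0 < b) (hbc : b < c) {n : ℕ}
    (e : Fin n → Bool) {ε : Fin n → ℝ} (hε : ∀ k, 0 < ε k) :
    Integrable (fun ω => ∏ k, relTime W (raySlope b c (e k)) (ε k) ω) P := by
  refine ⟨(aemeasurable_prod_relTime hW e ε).aestronglyMeasurable, ?_⟩
  rw [hasFiniteIntegral_iff_ofReal (ae_of_all _ fun ω =>
    Finset.prod_nonneg fun k _ => relTime_nonneg W _ (hε k) ω),
    lintegral_prod_relTime hW hb hbc e hε]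
  exact lintegral_prod_scaled_occupation_lt_top hW hb hbc e hε

lemma tendsto_integral_prod_relTime [IsProbabilityMeasure P] (hW : IsBrownianReal W P) (hb : 0 < b) (hbc : b < c) {n : ℕ}
    (e : Fin n → Bool) :
    Tendsto (fun ε : Fin n → ℝ => ∫ ω, ∏ k, relTime W (raySlope b c (e k)) (ε k) ω ∂P)
      (𝓝[{ε | ∀ k, 0 < ε k}] 0) (𝓝 (∑ σ : Equiv.Perm (Fin n), pathWeight b c (e ∘ σ))) := by
  have h := (ENNReal.tendsto_toReal ENNReal.ofReal_ne_top).comp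
    (tendsto_lintegral_prod_scaled_occupation hW hb hbc e)
  rw [ENNReal.toReal_ofReal (Finset.sum_nonneg fun σ _ => (pathWeight_pos hb hbc _).le)] at h
  refine h.congr' ?_
  filter_upwards [eventually_mem_nhdsWithin] with ε hε
  rw [integral_eq_lintegral_of_nonneg_ae (ae_of_all _ fun ω =>
    Finset.prod_nonneg fun k _ => relTime_nonneg W _ (hε k) ω)
    (aemeasurable_prod_relTime hW e ε).aestronglyMeasurable, lintegral_prod_relTime hW hb hbc e hε]
  rfl

end Moments

/-! ### Square-integrable limits -/

section Limits

variable {Ω : Type*} [MeasurableSpace Ω] {P : Measure Ω}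

/-- In the expansion of `‖f i - f j‖²` all three inner products tend to the same `M`, the squared
norms being the diagonal case, so the total tends to `M - 2M + M = 0`. -/
lemma exists_tendsto_of_tendsto_inner {ι H : Type*} [NormedAddCommGroup H]
    [InnerProductSpace ℝ H] [CompleteSpace H] {l : Filter ι} [l.NeBot] {f : ι → H} {M : ℝ}
    (h : Tendsto (fun p : ι × ι => inner ℝ (f p.1) (f p.2)) (l ×ˢ l) (𝓝 M)) :
    ∃ x, Tendsto f l (𝓝 x) := by
  refine cauchy_map_iff_exists_tendsto.1 (cauchy_map_iff.2 ⟨inferInstance, ?_⟩)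
  rw [Metric.uniformity_eq_comap_nhds_zero, tendsto_comap_iff]
  have h1 := h.comp ((tendsto_fst (f := l) (g := l)).prodMk tendsto_fst)
  have h2 := h.comp ((tendsto_snd (f := l) (g := l)).prodMk tendsto_snd)
  have h3 := ((h1.sub (h.const_mul 2)).add h2).sqrt
  rw [show M - 2 * M + M = 0 by ring, Real.sqrt_zero] at h3
  refine h3.congr fun p => ?_
  simp only [Function.comp]
  rw [dist_eq_norm, ← Real.sqrt_sq (norm_nonneg (f p.1 - f p.2)), @norm_sub_sq_real,
    real_inner_self_eq_norm_sq, real_inner_self_eq_norm_sq]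

lemma exists_memLp_two_limit {ι : Type*} {l : Filter ι} [l.NeBot] {f : ι → Ω → ℝ} {M : ℝ}
    (hf : ∀ᶠ i in l, MemLp (f i) 2 P)
    (h : Tendsto (fun p : ι × ι => ∫ ω, f p.1 ω * f p.2 ω ∂P) (l ×ˢ l) (𝓝 M)) :
    ∃ Z : Ω → ℝ, MemLp Z 2 P ∧ Tendsto (fun i => eLpNorm (f i - Z) 2 P) l (𝓝 0) := by
  classical
  set F : ι → Lp ℝ 2 P := fun i => if hi : MemLp (f i) 2 P then hi.toLp else 0 with hF
  have hFe : ∀ᶠ i in l, F i =ᵐ[P] f i := by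
    filter_upwards [hf] with i hi
    simp only [hF, dif_pos hi]
    exact hi.coeFn_toLp
  obtain ⟨Z, hZ⟩ : ∃ Z, Tendsto F l (𝓝 Z) := by
    refine exists_tendsto_of_tendsto_inner (M := M) (h.congr' ?_)
    filter_upwards [hFe.prod_mk hFe] with p hp
    rw [L2.inner_def]
    refine integral_congr_ae ?_
    filter_upwards [hp.1, hp.2] with ω h1 h2
    rw [h1, h2]
    simp [mul_comm]
  refine ⟨Z, Lp.memLp Z, ((Lp.tendsto_Lp_iff_tendsto_eLpNorm' _ _).1 hZ).congr' ?_⟩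
  filter_upwards [hFe] with i hi
  exact eLpNorm_congr_ae (hi.sub EventuallyEq.rfl)

variable {W : ℝ≥0 → Ω → ℝ} {b c : ℝ}

lemma tendsto_const_pos (n : ℕ) :
    Tendsto (fun (ε : ℝ) (_ : Fin n) => ε) (𝓝[>] 0) (𝓝[{ε : Fin n → ℝ | ∀ k, 0 < ε k}] 0) := by
  refine tendsto_nhdsWithin_iff.2 ⟨?_, eventually_mem_nhdsWithin.mono fun ε hε _ => hε⟩
  exact tendsto_pi_nhds.2 fun _ => nhdsWithin_le_nhds

lemma tendsto_append_pos (n : ℕ) :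
    Tendsto (fun p : ℝ × ℝ => Fin.append (fun _ : Fin n => p.1) (fun _ : Fin n => p.2))
      (𝓝[>] 0 ×ˢ 𝓝[>] 0) (𝓝[{ε : Fin (n + n) → ℝ | ∀ k, 0 < ε k}] 0) := by
  have h1 : Tendsto (fun p : ℝ × ℝ => p.1) (𝓝[>] 0 ×ˢ 𝓝[>] 0) (𝓝[>] (0 : ℝ)) := tendsto_fst
  have h2 : Tendsto (fun p : ℝ × ℝ => p.2) (𝓝[>] 0 ×ˢ 𝓝[>] 0) (𝓝[>] (0 : ℝ)) := tendsto_snd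
  refine tendsto_nhdsWithin_iff.2 ⟨tendsto_pi_nhds.2 fun k => ?_, ?_⟩
  · refine Fin.addCases (fun i => ?_) (fun i => ?_) k
    · simpa using h1.mono_right nhdsWithin_le_nhds
    · simpa only [Fin.append_right, Pi.zero_apply] using h2.mono_right nhdsWithin_le_nhds
  · filter_upwards [h1.eventually eventually_mem_nhdsWithin,
      h2.eventually eventually_mem_nhdsWithin] with p hp1 hp2 k
    refine Fin.addCases (fun i => ?_) (fun i => ?_) k
    · simpa using hp1
    · simpa only [Fin.append_right, Set.mem_Ioi] using hp2

lemma prod_relTime_append {Ω : Type*} (W : ℝ≥0 → Ω → ℝ) (b c : ℝ) {n : ℕ} (e : Fin n → Bool) (x y : ℝ)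
    (ω : Ω) :
    ∏ k, relTime W (raySlope b c (Fin.append e e k))
        (Fin.append (fun _ : Fin n => x) (fun _ : Fin n => y) k) ω
      = (∏ k, relTime W (raySlope b c (e k)) x ω) * ∏ k, relTime W (raySlope b c (e k)) y ω := by
  rw [Fin.prod_univ_add]
  simp only [Fin.append_left, Fin.append_right]

/-- The moment formula for the doubled word `Fin.append e e`, with one width on each half, supplies
both square integrability and the convergent inner products. On a probability space `L²` convergence
implies `L¹` convergence, so the mean passes to the limit. -/
lemma exists_limit_prod_relTime [IsProbabilityMeasure P] (hW : IsBrownianReal W P) (hb : 0 < b) (hbc : b < c) {n : ℕ}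
    (e : Fin n → Bool) :
    ∃ Z : Ω → ℝ, Integrable Z P ∧
      TendstoInMeasure P (fun (ε : ℝ) ω => ∏ k, relTime W (raySlope b c (e k)) ε ω) (𝓝[>] 0) Z ∧
      ∫ ω, Z ω ∂P = ∑ σ : Equiv.Perm (Fin n), pathWeight b c (e ∘ σ) := by
  have hmeas : ∀ ε : ℝ, AEStronglyMeasurable
      (fun ω => ∏ k, relTime W (raySlope b c (e k)) ε ω) P :=
    fun ε => (aemeasurable_prod_relTime hW e fun _ => ε).aestronglyMeasurable
  have hint : ∀ᶠ ε : ℝ in 𝓝[>] 0,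
      Integrable (fun ω => ∏ k, relTime W (raySlope b c (e k)) ε ω) P := by
    filter_upwards [eventually_mem_nhdsWithin] with ε hε
    exact integrable_prod_relTime hW hb hbc e (ε := fun _ => ε) fun _ => hε
  have hL2 : ∀ᶠ ε : ℝ in 𝓝[>] 0,
      MemLp (fun ω => ∏ k, relTime W (raySlope b c (e k)) ε ω) 2 P := by
    filter_upwards [eventually_mem_nhdsWithin] with ε hε
    rw [memLp_two_iff_integrable_sq (hmeas ε)]
    have := integrable_prod_relTime hW hb hbc (Fin.append e e)
      (ε := Fin.append (fun _ => ε) (fun _ => ε)) fun k => by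
        refine Fin.addCases (fun i => ?_) (fun i => ?_) k
        · simpa using hε
        · simpa only [Fin.append_right, Set.mem_Ioi] using hε
    simp_rw [prod_relTime_append] at this
    simpa only [sq] using this
  have hM := (tendsto_integral_prod_relTime hW hb hbc (Fin.append e e)).comp
    (tendsto_append_pos n)
  simp only [Function.comp_def, prod_relTime_append] at hM
  obtain ⟨Z, hZ2, hZ⟩ := exists_memLp_two_limit hL2 hM
  have hZint : Integrable Z P := hZ2.integrable (by norm_num)
  refine ⟨Z, hZint, tendstoInMeasure_of_tendsto_eLpNorm two_ne_zero hmeas hZ2.1 hZ, ?_⟩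
  have hL1 : Tendsto (fun ε : ℝ => eLpNorm
      ((fun ω => ∏ k, relTime W (raySlope b c (e k)) ε ω) - Z) 1 P) (𝓝[>] 0) (𝓝 0) :=
    tendsto_of_tendsto_of_tendsto_of_le_of_le tendsto_const_nhds hZ (fun _ => zero_le)
      fun ε => eLpNorm_le_eLpNorm_of_exponent_le (by norm_num) ((hmeas ε).sub hZ2.1)
  refine tendsto_nhds_unique (tendsto_integral_of_L1' Z hZint.1 hint hL1) ?_
  exact (tendsto_integral_prod_relTime hW hb hbc e).comp (tendsto_const_pos n)

lemma TendstoInMeasure.prodMk_real {ι : Type*} {l : Filter ι} {f g : ι → Ω → ℝ} {X Y : Ω → ℝ}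
    (hf : TendstoInMeasure P f l X) (hg : TendstoInMeasure P g l Y) :
    TendstoInMeasure P (fun i ω => (f i ω, g i ω)) l (fun ω => (X ω, Y ω)) := by
  intro η hη
  have h := (hf η hη).add (hg η hη)
  rw [add_zero] at h
  refine tendsto_of_tendsto_of_tendsto_of_le_of_le tendsto_const_nhds h (fun _ => zero_le)
    fun i => (measure_mono ?_).trans (measure_union_le _ _)
  intro ω hω
  simpa [Prod.edist_eq, le_max_iff] using hω

/-- The existence of a limit pair on the space of the Brownian motion, together with its product
moments. -/
lemma exists_limit_pair [IsProbabilityMeasure P] (hW : IsBrownianReal W P) (hb : 0 < b) (hbc : b < c) :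
    ∃ X Y : Ω → ℝ, AEMeasurable X P ∧ AEMeasurable Y P ∧ IsTotalRelTimePair W P b c X Y P ∧
      (∀ᵐ ω ∂P, 0 ≤ X ω ∧ 0 ≤ Y ω) ∧
      ∀ p q : ℕ, Integrable (fun ω => X ω ^ p * Y ω ^ q) P ∧
        ∫ ω, X ω ^ p * Y ω ^ q ∂P
          = (p ! : ℝ) * (q ! : ℝ) * ∑ e ∈ pathTypes p q, pathWeight b c e := by
  obtain ⟨X, hXi, hX, -⟩ := exists_limit_prod_relTime hW hb hbc (fun _ : Fin 1 => false)
  obtain ⟨Y, hYi, hY, -⟩ := exists_limit_prod_relTime hW hb hbc (fun _ : Fin 1 => true)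
  simp only [Finset.univ_unique, Finset.prod_const, Finset.card_singleton, pow_one] at hX hY
  have hpair := TendstoInMeasure.prodMk_real hX hY
  have hZ : ∀ p q : ℕ, ∃ Z : Ω → ℝ, Integrable Z P ∧
      (∀ᵐ ω ∂P, 0 ≤ X ω ∧ 0 ≤ Y ω ∧ Z ω = X ω ^ p * Y ω ^ q) ∧
      ∫ ω, Z ω ∂P = (p ! : ℝ) * (q ! : ℝ) * ∑ e ∈ pathTypes p q, pathWeight b c e := by
    intro p q
    obtain ⟨Z, hZi, hZ, hZm⟩ := exists_limit_prod_relTime hW hb hbc (sortedWord p q)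
    refine ⟨Z, hZi, ?_, hZm.trans (sum_perm_sortedWord _)⟩
    -- Along a common subsequence of widths the pair and the product converge almost surely, which
    -- identifies the limit of the product with `X ^ p * Y ^ q`.
    obtain ⟨ns, hns, hnsX⟩ := hpair.exists_seq_tendsto_ae'
    obtain ⟨ms, hms, hmsZ⟩ := (hZ.comp hns).exists_seq_tendsto_ae'
    filter_upwards [hnsX, hmsZ] with ω h1 h2
    have hpos : ∀ᶠ m in atTop, 0 < ns (ms m) :=
      (hns.comp hms).eventually eventually_mem_nhdsWithin
    have h1' := h1.comp hms
    have hx : Tendsto (fun m => relTime W (raySlope b c false) (ns (ms m)) ω) atTop (𝓝 (X ω)) :=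
      (continuous_fst.tendsto _).comp h1'
    have hy : Tendsto (fun m => relTime W (raySlope b c true) (ns (ms m)) ω) atTop (𝓝 (Y ω)) :=
      (continuous_snd.tendsto _).comp h1'
    refine ⟨ge_of_tendsto hx (hpos.mono fun m hm => relTime_nonneg W _ hm ω),
      ge_of_tendsto hy (hpos.mono fun m hm => relTime_nonneg W _ hm ω),
      tendsto_nhds_unique h2 (((hx.pow p).mul (hy.pow q)).congr fun m => ?_)⟩
    simp [Fin.prod_univ_add, sortedWord]
  refine ⟨X, Y, hXi.1.aemeasurable, hYi.1.aemeasurable, ?_, ?_, fun p q => ?_⟩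
  · exact hpair.tendstoInDistribution
      fun ε => (aemeasurable_relTime hW _ ε).prodMk (aemeasurable_relTime hW _ ε)
  · obtain ⟨Z, -, hZ', -⟩ := hZ 0 0
    filter_upwards [hZ'] with ω hω using ⟨hω.1, hω.2.1⟩
  · obtain ⟨Z, hZi, hZ', hZm⟩ := hZ p q
    have : Z =ᵐ[P] fun ω => X ω ^ p * Y ω ^ q := hZ'.mono fun ω hω => hω.2.2
    exact ⟨hZi.congr this, (integral_congr_ae this).symm.trans hZm⟩

end Limits

/-! ### The joint moment generating function -/

section GeneratingFunction

lemma HasSum.mul_of_summable_norm {f g : ℕ → ℝ} {x y : ℝ} (hf : HasSum f x) (hg : HasSum g y) :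
    HasSum (fun k : ℕ × ℕ => f k.1 * g k.2) (x * y) :=
  hf.mul hg (summable_mul_of_summable_norm hf.summable.norm hg.summable.norm)

lemma hasSum_exp_add (x y : ℝ) :
    HasSum (fun k : ℕ × ℕ => x ^ k.1 / (k.1 ! : ℝ) * (y ^ k.2 / (k.2 ! : ℝ)))
      (Real.exp (x + y)) := by
  have h : ∀ z : ℝ, HasSum (fun n : ℕ => z ^ n / (n ! : ℝ)) (Real.exp z) := fun z => by
    rw [Real.exp_eq_exp_ℝ]; exact NormedSpace.expSeries_div_hasSum_exp z
  rw [Real.exp_add]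
  exact HasSum.mul_of_summable_norm (f := fun n => x ^ n / (n ! : ℝ))
    (g := fun n => y ^ n / (n ! : ℝ)) (h x) (h y)

lemma summable_iff_tsum_ofReal_ne_top {ι : Type*} {f : ι → ℝ} (hf : ∀ i, 0 ≤ f i) :
    Summable f ↔ ∑' i, ENNReal.ofReal (f i) ≠ ⊤ := by
  refine ⟨fun h => h.tsum_ofReal_ne_top, fun h => ?_⟩
  simpa [ENNReal.toReal_ofReal (hf _)] using ENNReal.summable_toReal h

/-- Grouped by total degree `n`, the terms sum to `(x + y) ^ n`, a geometric series. -/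
lemma summable_binomial {x y : ℝ} (hx : 0 ≤ x) (hy : 0 ≤ y) (h : x + y < 1) :
    Summable (fun k : ℕ × ℕ => ((k.1 + k.2).choose k.1 : ℝ) * (x ^ k.1 * y ^ k.2)) := by
  have hnn : ∀ k : ℕ × ℕ, 0 ≤ ((k.1 + k.2).choose k.1 : ℝ) * (x ^ k.1 * y ^ k.2) :=
    fun k => by positivity
  refine (Finset.HasAntidiagonal.sigmaAntidiagonalEquivProd (A := ℕ)).summable_iff.1 ?_
  refine (summable_sigma_of_nonneg fun k => hnn _).2 ⟨fun n => Summable.of_finite, ?_⟩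
  have hn : ∀ n : ℕ, ∑' k : Finset.HasAntidiagonal.antidiagonal n, ((fun k : ℕ × ℕ =>
      ((k.1 + k.2).choose k.1 : ℝ) * (x ^ k.1 * y ^ k.2)) ∘
      Finset.HasAntidiagonal.sigmaAntidiagonalEquivProd) ⟨n, k⟩ = (x + y) ^ n := by
    intro n
    rw [tsum_fintype, (Commute.all x y).add_pow']
    rw [← Finset.sum_coe_sort (Finset.HasAntidiagonal.antidiagonal n)]
    refine Finset.sum_congr rfl fun k _ => ?_
    have hk := Finset.HasAntidiagonal.mem_antidiagonal.1 k.2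
    simp only [Function.comp, Finset.HasAntidiagonal.sigmaAntidiagonalEquivProd_apply, hk, nsmul_eq_mul]
  exact (summable_geometric_of_lt_one (by positivity) h).congr fun n => (hn n).symm

lemma sum_pathWeight_nonneg {b c : ℝ} (hb : 0 < b) (hbc : b < c) (p q : ℕ) :
    0 ≤ ∑ e ∈ pathTypes p q, pathWeight b c e :=
  Finset.sum_nonneg fun _ _ => (pathWeight_pos hb hbc _).le

lemma sum_pathWeight_le {b c : ℝ} (hb : 0 < b) (hbc : b < c) (p q : ℕ) :
    ∑ e ∈ pathTypes p q, pathWeight b c e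
      ≤ ((p + q).choose p : ℝ) * ((1 / b) ^ p * (1 / c) ^ q) := by
  rw [← card_pathTypes, ← nsmul_eq_mul]
  exact Finset.sum_le_card_nsmul _ _ _ fun e he => pathWeight_le hb hbc he

lemma summable_pathWeight {b c : ℝ} (hb : 0 < b) (hbc : b < c) {s t : ℝ}
    (h : |s| / b + |t| / c < 1) :
    Summable (fun k : ℕ × ℕ =>
      |s| ^ k.1 * |t| ^ k.2 * ∑ e ∈ pathTypes k.1 k.2, pathWeight b c e) := by
  have hc : 0 < c := hb.trans hbc
  refine Summable.of_nonneg_of_le (fun k => ?_) (fun k => ?_)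
    (summable_binomial (x := |s| / b) (y := |t| / c) (by positivity) (by positivity) h)
  · have := sum_pathWeight_nonneg hb hbc k.1 k.2
    positivity
  · refine (mul_le_mul_of_nonneg_left (sum_pathWeight_le hb hbc k.1 k.2)
      (by positivity)).trans_eq ?_
    simp only [div_pow, one_pow]
    ring

variable {Ω : Type*} [MeasurableSpace Ω] {P : Measure Ω} {X Y : Ω → ℝ} {m : ℕ → ℕ → ℝ}

/-- All terms of the exponential series are nonnegative, so it may be integrated termwise even when
both sides are infinite; the factorials cancel against those in the moments. -/
lemma lintegral_exp_eq_tsum (hX : AEMeasurable X P) (hY : AEMeasurable Y P)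
    (h0 : ∀ᵐ ω ∂P, 0 ≤ X ω ∧ 0 ≤ Y ω)
    (hm : ∀ p q, Integrable (fun ω => X ω ^ p * Y ω ^ q) P ∧
      ∫ ω, X ω ^ p * Y ω ^ q ∂P = (p ! : ℝ) * (q ! : ℝ) * m p q)
    {s t : ℝ} (hs : 0 ≤ s) (ht : 0 ≤ t) :
    ∫⁻ ω, ENNReal.ofReal (Real.exp (s * X ω + t * Y ω)) ∂P
      = ∑' k : ℕ × ℕ, ENNReal.ofReal (s ^ k.1 * t ^ k.2 * m k.1 k.2) := by
  have h1 : ∀ᵐ ω ∂P, ENNReal.ofReal (Real.exp (s * X ω + t * Y ω))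
      = ∑' k : ℕ × ℕ, ENNReal.ofReal ((s ^ k.1 / (k.1 ! : ℝ) * (t ^ k.2 / (k.2 ! : ℝ))) *
        (X ω ^ k.1 * Y ω ^ k.2)) := by
    filter_upwards [h0] with ω hω
    obtain ⟨hx, hy⟩ := hω
    have h := hasSum_exp_add (s * X ω) (t * Y ω)
    rw [← h.tsum_eq, ENNReal.ofReal_tsum_of_nonneg (fun k => by positivity) h.summable]
    refine tsum_congr fun k => ?_
    congr 1
    rw [mul_pow, mul_pow]
    ring
  rw [lintegral_congr_ae h1, lintegral_tsum]
  · refine tsum_congr fun k => ?_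
    have hc : 0 ≤ s ^ k.1 / (k.1 ! : ℝ) * (t ^ k.2 / (k.2 ! : ℝ)) := by positivity
    simp_rw [ENNReal.ofReal_mul hc]
    rw [lintegral_const_mul' _ _ ENNReal.ofReal_ne_top, ← ofReal_integral_eq_lintegral_ofReal
      (hm k.1 k.2).1 (h0.mono fun ω hω => mul_nonneg (pow_nonneg hω.1 _) (pow_nonneg hω.2 _)),
      (hm k.1 k.2).2, ← ENNReal.ofReal_mul hc]
    congr 1
    field_simp
  · intro k
    exact (((hX.pow_const _).mul (hY.pow_const _)).const_mul _).ennreal_ofReal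

lemma summable_iff_integrable_exp (hX : AEMeasurable X P) (hY : AEMeasurable Y P)
    (h0 : ∀ᵐ ω ∂P, 0 ≤ X ω ∧ 0 ≤ Y ω) (hm0 : ∀ p q, 0 ≤ m p q)
    (hm : ∀ p q, Integrable (fun ω => X ω ^ p * Y ω ^ q) P ∧
      ∫ ω, X ω ^ p * Y ω ^ q ∂P = (p ! : ℝ) * (q ! : ℝ) * m p q)
    {s t : ℝ} (hs : 0 ≤ s) (ht : 0 ≤ t) :
    Summable (fun k : ℕ × ℕ => s ^ k.1 * t ^ k.2 * m k.1 k.2)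
      ↔ Integrable (fun ω => Real.exp (s * X ω + t * Y ω)) P := by
  rw [summable_iff_tsum_ofReal_ne_top fun k => by have := hm0 k.1 k.2; positivity,
    ← lintegral_exp_eq_tsum hX hY h0 hm hs ht, ← lt_top_iff_ne_top,
    ← hasFiniteIntegral_iff_ofReal (ae_of_all _ fun ω => (Real.exp_pos _).le)]
  have : AEStronglyMeasurable (fun ω => Real.exp (s * X ω + t * Y ω)) P :=
    (Real.measurable_exp.comp_aemeasurable
      ((hX.const_mul s).add (hY.const_mul t))).aestronglyMeasurable
  exact ⟨fun h => ⟨this, h⟩, fun h => h.2⟩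

/-- The norms of the terms integrate to the terms of the series in `|s|`, `|t|`, whose convergence
permits exchanging sum and integral. -/
lemma hasSum_integral_exp (hX : AEMeasurable X P) (hY : AEMeasurable Y P)
    (h0 : ∀ᵐ ω ∂P, 0 ≤ X ω ∧ 0 ≤ Y ω) (hm0 : ∀ p q, 0 ≤ m p q)
    (hm : ∀ p q, Integrable (fun ω => X ω ^ p * Y ω ^ q) P ∧
      ∫ ω, X ω ^ p * Y ω ^ q ∂P = (p ! : ℝ) * (q ! : ℝ) * m p q)
    {s t : ℝ} (h : Summable (fun k : ℕ × ℕ => |s| ^ k.1 * |t| ^ k.2 * m k.1 k.2)) :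
    Integrable (fun ω => Real.exp (s * X ω + t * Y ω)) P ∧
      HasSum (fun k : ℕ × ℕ => s ^ k.1 * t ^ k.2 * m k.1 k.2)
        (∫ ω, Real.exp (s * X ω + t * Y ω) ∂P) := by
  constructor
  · refine ((summable_iff_integrable_exp hX hY h0 hm0 hm (abs_nonneg s) (abs_nonneg t)).1 h).mono'
      (Real.measurable_exp.comp_aemeasurable
        ((hX.const_mul s).add (hY.const_mul t))).aestronglyMeasurable ?_
    filter_upwards [h0] with ω hω
    rw [Real.norm_eq_abs, Real.abs_exp]
    exact Real.exp_le_exp.2 (add_le_add (mul_le_mul_of_nonneg_right (le_abs_self s) hω.1)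
      (mul_le_mul_of_nonneg_right (le_abs_self t) hω.2))
  · set F : ℕ × ℕ → Ω → ℝ := fun k ω =>
      (s ^ k.1 / (k.1 ! : ℝ) * (t ^ k.2 / (k.2 ! : ℝ))) * (X ω ^ k.1 * Y ω ^ k.2) with hF
    have hFi : ∀ k, Integrable (F k) P := fun k => (hm k.1 k.2).1.const_mul _
    have hFn : ∀ k, ∫ ω, ‖F k ω‖ ∂P = |s| ^ k.1 * |t| ^ k.2 * m k.1 k.2 := by
      intro k
      have : (fun ω => ‖F k ω‖) =ᵐ[P] fun ω =>
          (|s| ^ k.1 / (k.1 ! : ℝ) * (|t| ^ k.2 / (k.2 ! : ℝ))) * (X ω ^ k.1 * Y ω ^ k.2) := by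
        filter_upwards [h0] with ω hω
        simp [hF, abs_of_nonneg hω.1, abs_of_nonneg hω.2]
      rw [integral_congr_ae this, integral_const_mul, (hm k.1 k.2).2]
      field_simp
    have hsum := hasSum_integral_of_summable_integral_norm hFi (by simpa only [hFn] using h)
    have hFs : ∀ k, ∫ ω, F k ω ∂P = s ^ k.1 * t ^ k.2 * m k.1 k.2 := by
      intro k
      refine (integral_const_mul _ _).trans ?_
      rw [(hm k.1 k.2).2]
      field_simp
    simp only [hFs] at hsum
    have hexp : ∀ ω, Real.exp (s * X ω + t * Y ω) = ∑' k, F k ω := fun ω => ?_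
    · simpa only [hexp] using hsum
    rw [← (hasSum_exp_add (s * X ω) (t * Y ω)).tsum_eq]
    refine tsum_congr fun k => ?_
    simp only [hF]
    rw [mul_pow, mul_pow]
    ring

end GeneratingFunction

theorem mainTheorem7 {Ω : Type*} [MeasurableSpace Ω] (P : Measure Ω) [IsProbabilityMeasure P]
    (W : ℝ≥0 → Ω → ℝ) (hW : IsBrownianReal W P) (b c : ℝ) (hb : 0 < b) (hbc : b < c) :
    -- contribution of a single path type
    (∀ (n : ℕ) (e : Fin n → Bool),
      IntegrableOn (fun t => brownianDensity t (fun k => raySlope b c (e k) * t k))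
        (orderedTimes n) ∧
      ∫ t in orderedTimes n, brownianDensity t (fun k => raySlope b c (e k) * t k)
        = pathWeight b c e) ∧
    -- number of path types, and sums of the even and of the odd run lengths
    (∀ p q : ℕ, (pathTypes p q).card = (p + q).choose p ∧
      ∀ e ∈ pathTypes p q,
        ∑ j ∈ (Finset.range (p + q + 1)).filter Even, runLength e j = p ∧
        ∑ j ∈ (Finset.range (p + q + 1)).filter Odd, runLength e j = q) ∧
    -- existence of the limit law of the pair
    (∃ (ν : Measure (ℝ × ℝ)) (_ : IsProbabilityMeasure ν),
      IsTotalRelTimePair W P b c Prod.fst Prod.snd ν) ∧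
    ∀ (Ω' : Type*) [MeasurableSpace Ω'] (P' : Measure Ω') [IsProbabilityMeasure P']
      (X Y : Ω' → ℝ), IsTotalRelTimePair W P b c X Y P' →
      -- product moments
      (∀ p q : ℕ, Integrable (fun ω => X ω ^ p * Y ω ^ q) P' ∧
        ∫ ω, X ω ^ p * Y ω ^ q ∂P'
          = (p ! : ℝ) * (q ! : ℝ) * ∑ e ∈ pathTypes p q, pathWeight b c e) ∧
      -- joint moment generating function
      ∀ s t : ℝ,
        (|s| / b + |t| / c < 1 →
          Summable (fun k : ℕ × ℕ =>
            |s| ^ k.1 * |t| ^ k.2 * ∑ e ∈ pathTypes k.1 k.2, pathWeight b c e)) ∧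
        (Summable (fun k : ℕ × ℕ =>
            |s| ^ k.1 * |t| ^ k.2 * ∑ e ∈ pathTypes k.1 k.2, pathWeight b c e) ↔
          Integrable (fun ω => Real.exp (|s| * X ω + |t| * Y ω)) P') ∧
        (Summable (fun k : ℕ × ℕ =>
            |s| ^ k.1 * |t| ^ k.2 * ∑ e ∈ pathTypes k.1 k.2, pathWeight b c e) →
          Integrable (fun ω => Real.exp (s * X ω + t * Y ω)) P' ∧
          HasSum (fun k : ℕ × ℕ =>
              s ^ k.1 * t ^ k.2 * ∑ e ∈ pathTypes k.1 k.2, pathWeight b c e)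
            (∫ ω, Real.exp (s * X ω + t * Y ω) ∂P')) := by
  obtain ⟨X₀, Y₀, hX₀, hY₀, hlim, hnonneg, hmom⟩ := exists_limit_pair hW hb hbc
  refine ⟨fun n e => ⟨integrableOn_brownianDensity_word hb hbc e,
    integral_brownianDensity_word hb hbc e⟩,
    fun p q => ⟨card_pathTypes p q, fun e he => sum_runLength he⟩,
    ⟨P.map (fun ω => (X₀ ω, Y₀ ω)), Measure.isProbabilityMeasure_map (hX₀.prodMk hY₀), ?_⟩, ?_⟩
  · have := Measure.isProbabilityMeasure_map (hX₀.prodMk hY₀)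
    refine ⟨hlim.forall_aemeasurable, by fun_prop, ?_⟩
    convert hlim.tendsto using 3
    congr 1
    exact Subtype.ext Measure.map_id
  intro Ω' _ P' _ X Y hXY
  -- A limit in distribution has a unique law, so moments and signs transfer from the pair
  -- constructed on the space of `W`.
  have hlaw : P'.map (fun ω => (X ω, Y ω)) = P.map (fun ω => (X₀ ω, Y₀ ω)) :=
    tendstoInDistribution_unique _ hXY hlim
  have hid : IdentDistrib (fun ω => (X ω, Y ω)) (fun ω => (X₀ ω, Y₀ ω)) P' P :=
    ⟨hXY.aemeasurable_limit, hX₀.prodMk hY₀, hlaw⟩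
  have hX : AEMeasurable X P' := measurable_fst.comp_aemeasurable hXY.aemeasurable_limit
  have hY : AEMeasurable Y P' := measurable_snd.comp_aemeasurable hXY.aemeasurable_limit
  have h0 : ∀ᵐ ω ∂P', 0 ≤ X ω ∧ 0 ≤ Y ω :=
    hid.symm.ae_snd (p := fun z : ℝ × ℝ => 0 ≤ z.1 ∧ 0 ≤ z.2)
      ((measurableSet_le measurable_const measurable_fst).inter
        (measurableSet_le measurable_const measurable_snd)) hnonneg
  have hm : ∀ p q : ℕ, Integrable (fun ω => X ω ^ p * Y ω ^ q) P' ∧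
      ∫ ω, X ω ^ p * Y ω ^ q ∂P'
        = (p ! : ℝ) * (q ! : ℝ) * ∑ e ∈ pathTypes p q, pathWeight b c e := by
    intro p q
    have h := hid.comp (u := fun z : ℝ × ℝ => z.1 ^ p * z.2 ^ q) (by fun_prop)
    exact ⟨h.integrable_iff.2 (hmom p q).1, h.integral_eq.trans (hmom p q).2⟩
  have hm0 := sum_pathWeight_nonneg hb hbc
  exact ⟨hm, fun s t => ⟨summable_pathWeight hb hbc,
    summable_iff_integrable_exp (m := fun p q => ∑ e ∈ pathTypes p q, pathWeight b c e)
      hX hY h0 hm0 hm (abs_nonneg s) (abs_nonneg t),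
    hasSum_integral_exp (m := fun p q => ∑ e ∈ pathTypes p q, pathWeight b c e)
      hX hY h0 hm0 hm⟩⟩
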